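/- Let $n\ge 2$. There is a constant $C\ge 1$, depending only on $n$, such that the following holds. Let $R>0$, write $B_\rho(x)$ for the open ball in $\mathbb R^n$ of radius $\rho$ centered at $x$ and $B_\rho=B_\rho(0)$, and let $V\colon B_R\to\mathbb R$ and $W\colon B_R\to\mathbb R^n$ satisfy $$\|V\|_{W^{1,\infty}(B_R)}+\|W\|_{W^{1,\infty}(B_R)}\le 1,\qquad\text{where } \|f\|_{W^{1,\infty}(B_R)}=\|f\|_{L^\infty(B_R)}+\|Df\|_{L^\infty(B_R)} .$$ Let $u\in H^1_{\mathrm{loc}}(B_R)$ be a real-valued weak solution, not almost everywhere zero, of $$\Delta u=W\cdot\nabla u+Vu\quad\text{in } B_R ,$$ and suppose that $\|u\|_{L^2(B_R)}\le K\|u\|_{L^2(B_{R/2})}$ for a constant $K\ge 1$. Set $H(x,r)=\int_{B_r(x)}u^2\,dy$. Then, for all $x\in B_{R/2}$ and $r\in(0,R/8]$, we have $H(x,r)>0$ and $$\log\left(\frac{H(x,2r)}{H(x,r)}\right)\le C\,(R^2+\log K).$$ -/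

import Mathlib

open MeasureTheory Metric Set
open scoped ENNReal ContDiff

namespace SchrodingerDoubling

/-- `f'` is the weak (distributional) derivative of `f` on the open set `Ω ⊆ ℝⁿ`: both are locally
integrable on `Ω`, and `∫_Ω (∂_v φ) f = - ∫_Ω φ (f' v)` for every direction `v` and every test
function `φ ∈ C_c^∞(Ω)`. -/
def HasWeakFDerivOn {n : ℕ} {F : Type*} [NormedAddCommGroup F] [NormedSpace ℝ F] [CompleteSpace F]
    (Ω : Set (EuclideanSpace ℝ (Fin n))) (f : EuclideanSpace ℝ (Fin n) → F)
    (f' : EuclideanSpace ℝ (Fin n) → EuclideanSpace ℝ (Fin n) →L[ℝ] F) : Prop :=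
  LocallyIntegrableOn f Ω ∧ LocallyIntegrableOn f' Ω ∧
    ∀ φ : EuclideanSpace ℝ (Fin n) → ℝ, ContDiff ℝ ∞ φ → HasCompactSupport φ → tsupport φ ⊆ Ω →
      ∀ v : EuclideanSpace ℝ (Fin n),
        ∫ x in Ω, (fderiv ℝ φ x v) • f x = - ∫ x in Ω, φ x • (f' x v)

/-- The norm `‖f‖_{W^{1,∞}(Ω)} = ‖f‖_{L^∞(Ω)} + ‖Df‖_{L^∞(Ω)}`, with values in `[0, ∞]`. The weak
derivative is unique almost everywhere, so all terms of the infimum agree; the value is `∞` if `f`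
has no weak derivative on `Ω`. -/
noncomputable def w1inftyNorm {n : ℕ} {F : Type*} [NormedAddCommGroup F] [NormedSpace ℝ F]
    [CompleteSpace F] (Ω : Set (EuclideanSpace ℝ (Fin n)))
    (f : EuclideanSpace ℝ (Fin n) → F) : ℝ≥0∞ :=
  ⨅ (f' : EuclideanSpace ℝ (Fin n) → EuclideanSpace ℝ (Fin n) →L[ℝ] F)
    (_ : HasWeakFDerivOn Ω f f'),
      eLpNorm f ∞ (volume.restrict Ω) + eLpNorm f' ∞ (volume.restrict Ω)

/-- `u ∈ H¹_loc(Ω)` is a weak solution of `Δu = W · ∇u + V u` in the open set `Ω`. Here `G` is the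
weak gradient `∇u`, and `fderiv ℝ φ x (G x)` is `∇u(x) · ∇φ(x)`. -/
def IsSolutionOn {n : ℕ} (Ω : Set (EuclideanSpace ℝ (Fin n)))
    (W : EuclideanSpace ℝ (Fin n) → EuclideanSpace ℝ (Fin n))
    (V u : EuclideanSpace ℝ (Fin n) → ℝ) : Prop :=
  ∃ G : EuclideanSpace ℝ (Fin n) → EuclideanSpace ℝ (Fin n),
    HasWeakFDerivOn Ω u (fun x => innerSL ℝ (G x)) ∧
    (∀ S ⊆ Ω, IsCompact S → MemLp u 2 (volume.restrict S) ∧ MemLp G 2 (volume.restrict S)) ∧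
    ∀ φ : EuclideanSpace ℝ (Fin n) → ℝ, ContDiff ℝ ∞ φ → HasCompactSupport φ → tsupport φ ⊆ Ω →
      - ∫ x in Ω, fderiv ℝ φ x (G x) = ∫ x in Ω, (inner ℝ (W x) (G x) + V x * u x) * φ x

/-- `H(x, r) = ∫_{B_r(x)} u²`. -/
noncomputable def H {n : ℕ} (u : EuclideanSpace ℝ (Fin n) → ℝ) (x : EuclideanSpace ℝ (Fin n))
    (r : ℝ) : ℝ :=
  ∫ y in ball x r, u y ^ 2

end SchrodingerDoubling

open Filter Topology ContinuousLinearMap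
open scoped Convolution

local notation "𝔼" n => EuclideanSpace ℝ (Fin n)

namespace SchrodingerDoubling

/-! ### Mollification in `L²` -/

/-! The proof is a monotonicity formula for a weighted Almgren frequency. Put `w = (r² - |x -
x₀|²)₊`, `h(r) = ∫ w^α u²`, `d(r) = ∫ w^(α+1) |∇u|²` and `N = d / h`. Since `w` vanishes on the
sphere of radius `r`, every integration by parts is free of boundary terms. The fields `(x - x₀)
u²`, `u ∇u` and Pohozaev's field express `r h'` and `r d'` with the same leading coefficient `2α +
n`, which cancels in `N'`. Completing a square then bounds `N'` from below, with an error that is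
divided by `α + 1`; the equation enters through `|Δu| ≤ |∇u| + |u|`. This is
`frequency_inequalities`.

Consequently `exp(r² / (4(α + 1))) (N + r²)` is nondecreasing. Taking `α` comparable to `1 + R²`
keeps the exponential bounded by an absolute constant, at a cost linear in `α` when `h` is compared
with `H`; this is the source of the term `R²`. Because `N` controls the logarithmic derivative of
`h` from both sides, growth between two large radii bounds growth at all smaller ones
(`FrequencyPair.doubling`, then `doubling_of_growth` for `H`). The same bound prevents `h` from
vanishing at a smaller radius.

The hypothesis with `K` gives doubling at the origin, and a chain of four overlapping balls carries
it to any `x` in `B_{R/2}`. This yields a bound by `1 + R² + log K`. The summand `1` is absorbed by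
`growth_lower_bound`: for small `R` the mass of `u` must grow by a definite factor from `B_{R/2}` to
`B_{9R/10}`, so `R² + log K` cannot be small.

No `H²` regularity is needed: the final identities contain second derivatives only through `Δu`, so
they pass to the limit from mollifications with `u`, `∇u` and `Δu` converging in `L²`
(`exists_smooth_approx`). -/

lemma lintegral_mul_sq_le_of_prob {α : Type*} [MeasurableSpace α] {μ : Measure α}
    {p : α → ℝ≥0∞} (hp : Measurable p) (hp1 : ∫⁻ x, p x ∂μ = 1)
    {f : α → ℝ} (hf : AEStronglyMeasurable f μ) :
    (∫⁻ x, p x * ‖f x‖ₑ ∂μ) ^ 2 ≤ ∫⁻ x, p x * ‖f x‖ₑ ^ 2 ∂μ := by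
  -- Against the probability measure `p μ` this is the comparison of the `L¹` and `L²` norms.
  have hpr : IsProbabilityMeasure (μ.withDensity p) := ⟨by simp [hp1]⟩
  have hf' : AEStronglyMeasurable f (μ.withDensity p) :=
    hf.mono_ac (withDensity_absolutelyContinuous _ _)
  have h := eLpNorm_le_eLpNorm_of_exponent_le (p := 1) (q := 2) (by norm_num) hf'
  have h2 := pow_le_pow_left' h 2
  have h3 : eLpNorm f 2 (μ.withDensity p) ^ 2 = ∫⁻ x, ‖f x‖ₑ ^ 2 ∂(μ.withDensity p) := by
    simpa using eLpNorm_nnreal_pow_eq_lintegral (f := f) (μ := μ.withDensity p) (p := 2) (by simp)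
  rw [h3, eLpNorm_one_eq_lintegral_enorm] at h2
  rwa [lintegral_withDensity_eq_lintegral_mul₀' hp.aemeasurable hf'.enorm,
    lintegral_withDensity_eq_lintegral_mul₀' hp.aemeasurable (hf'.enorm.pow_const 2)] at h2

/-- Young's inequality for the `L²` norm of a mollification. -/
lemma eLpNorm_normed_convolution_le {n : ℕ} (φ : ContDiffBump (0 : 𝔼 n)) {g : (𝔼 n) → ℝ}
    (hg : AEStronglyMeasurable g volume) :
    eLpNorm (φ.normed volume ⋆[lsmul ℝ ℝ, volume] g) 2 volume ≤ eLpNorm g 2 volume := by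
  set p : (𝔼 n) → ℝ≥0∞ := fun t => ‖φ.normed volume t‖ₑ with hpdef
  have hp : Measurable p := φ.contDiff_normed (n := 0).continuous.measurable.enorm
  have hp1 : ∫⁻ t, p t = 1 := by
    have h := ofReal_integral_eq_lintegral_ofReal (φ.integrable_normed (μ := volume))
      (ae_of_all _ fun t => φ.nonneg_normed t)
    rw [φ.integral_normed] at h
    simp only [hpdef, Real.enorm_of_nonneg (φ.nonneg_normed _)]
    simpa using h.symm
  have key : ∫⁻ x, ‖(φ.normed volume ⋆[lsmul ℝ ℝ, volume] g) x‖ₑ ^ 2 ≤ ∫⁻ x, ‖g x‖ₑ ^ 2 := by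
    calc ∫⁻ x, ‖(φ.normed volume ⋆[lsmul ℝ ℝ, volume] g) x‖ₑ ^ 2
        ≤ ∫⁻ x, ∫⁻ t, p t * ‖g (x - t)‖ₑ ^ 2 := by
          refine lintegral_mono fun x => ?_
          refine le_trans ?_ (lintegral_mul_sq_le_of_prob hp hp1
            (hg.comp_quasiMeasurePreserving (quasiMeasurePreserving_sub_left volume x)))
          refine pow_le_pow_left' ?_ 2
          refine (enorm_integral_le_lintegral_enorm _).trans (lintegral_mono fun t => ?_)
          simp [hpdef, enorm_mul]
      _ = ∫⁻ t, ∫⁻ x, p t * ‖g (x - t)‖ₑ ^ 2 := by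
          refine lintegral_lintegral_swap ?_
          have h1 : AEStronglyMeasurable (fun q : (𝔼 n) × (𝔼 n) => g (q.1 - q.2))
              (volume.prod volume) :=
            hg.comp_quasiMeasurePreserving (quasiMeasurePreserving_sub volume volume)
          exact (hp.comp measurable_snd).aemeasurable.mul (h1.enorm.pow_const 2)
      _ = ∫⁻ t, p t * ∫⁻ x, ‖g x‖ₑ ^ 2 := by
          refine lintegral_congr fun t => ?_
          rw [lintegral_const_mul' _ _ (by simp [hpdef])]
          rw [lintegral_sub_right_eq_self (fun x => ‖g x‖ₑ ^ 2) t]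
      _ = ∫⁻ x, ‖g x‖ₑ ^ 2 := by
          rw [lintegral_mul_const _ hp, hp1, one_mul]
  have e : ∀ h : (𝔼 n) → ℝ, eLpNorm h 2 volume ^ 2 = ∫⁻ x, ‖h x‖ₑ ^ 2 := fun h => by
    simpa using eLpNorm_nnreal_pow_eq_lintegral (f := h) (μ := volume) (p := 2) (by simp)
  rw [← e, ← e] at key
  exact (ENNReal.pow_le_pow_left_iff two_ne_zero).1 key

/-- Mollifications of an `L²` function converge in `L²` on sets of finite measure. -/
lemma tendsto_eLpNorm_mollify_sub {n : ℕ} {φ : ℕ → ContDiffBump (0 : 𝔼 n)}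
    (hφ : Tendsto (fun k => (φ k).rOut) atTop (𝓝 0)) {g : (𝔼 n) → ℝ} (hg : MemLp g 2 volume)
    {S : Set (𝔼 n)} (hS : volume S ≠ ⊤) :
    Tendsto (fun k => eLpNorm (((φ k).normed volume ⋆[lsmul ℝ ℝ, volume] g) - g) 2
      (volume.restrict S)) atTop (𝓝 0) := by
  rw [ENNReal.tendsto_atTop_zero]
  intro ε hε
  by_cases htop : ε = ⊤
  · exact ⟨0, fun k _ => htop ▸ le_top⟩
  have hε3 : ε / 3 ≠ 0 := by simp [hε.ne']
  -- Split through a continuous compactly supported `h`: Young's inequality handles the mollified `g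
  -- - h`, and uniform continuity handles `h` itself.
  obtain ⟨h, hcs, hgh, hc, hmem⟩ := hg.exists_hasCompactSupport_eLpNorm_sub_le (by norm_num) hε3
  have huc : UniformContinuous h := hcs.uniformContinuous_of_continuous hc
  obtain ⟨δ, hδ, hδS⟩ : ∃ δ : ℝ, 0 < δ ∧
      volume S ^ (1 / (2 : ℝ)) * ENNReal.ofReal δ ≤ ε / 3 := by
    have hm : volume S ^ (1 / (2 : ℝ)) ≠ ⊤ := ENNReal.rpow_ne_top_of_nonneg (by norm_num) hS
    have : Tendsto (fun δ : ℝ => volume S ^ (1 / (2 : ℝ)) * ENNReal.ofReal δ) (𝓝[>] 0) (𝓝 0) := by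
      have h0 : Tendsto (fun δ : ℝ => ENNReal.ofReal δ) (𝓝[>] 0) (𝓝 0) := by
        have := (ENNReal.continuous_ofReal.tendsto 0)
        rw [ENNReal.ofReal_zero] at this
        exact this.mono_left nhdsWithin_le_nhds
      simpa using ENNReal.Tendsto.const_mul h0 (Or.inr hm)
    have hev := (this.eventually (ge_mem_nhds (pos_iff_ne_zero.2 hε3))).and self_mem_nhdsWithin
    obtain ⟨δ, h1, h2⟩ := hev.exists
    exact ⟨δ, h2, h1⟩
  obtain ⟨η, hη, hηh⟩ := Metric.uniformContinuous_iff.1 huc δ hδ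
  obtain ⟨N, hN⟩ := eventually_atTop.1 (hφ.eventually (gt_mem_nhds hη))
  refine ⟨N, fun k hk => ?_⟩
  have hint : ∀ q : (𝔼 n) → ℝ, MemLp q 2 volume →
      ConvolutionExists (φ k |>.normed volume) q (lsmul ℝ ℝ) volume := fun q hq =>
    (φ k).hasCompactSupport_normed.convolutionExists_left _ ((φ k).contDiff_normed (n := 0)).continuous
      (hq.locallyIntegrable (by norm_num))
  have e1 : ((φ k).normed volume ⋆[lsmul ℝ ℝ, volume] g) - g =
      ((φ k).normed volume ⋆[lsmul ℝ ℝ, volume] (g - h)) +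
        ((((φ k).normed volume ⋆[lsmul ℝ ℝ, volume] h) - h) + (h - g)) := by
    have : ((φ k).normed volume ⋆[lsmul ℝ ℝ, volume] g) =
        ((φ k).normed volume ⋆[lsmul ℝ ℝ, volume] (g - h)) +
        ((φ k).normed volume ⋆[lsmul ℝ ℝ, volume] h) := by
      rw [← (hint _ (hg.sub hmem)).distrib_add (hint _ hmem)]
      simp
    rw [this]; abel
  have hcont : ∀ q : (𝔼 n) → ℝ, MemLp q 2 volume →
      Continuous ((φ k).normed volume ⋆[lsmul ℝ ℝ, volume] q) := fun q hq =>
    (φ k).hasCompactSupport_normed.continuous_convolution_left _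
      ((φ k).contDiff_normed (n := 0)).continuous (hq.locallyIntegrable (by norm_num))
  have hc1 := hcont _ (hg.sub hmem)
  have hc2 := hcont _ hmem
  have A1 : eLpNorm ((φ k).normed volume ⋆[lsmul ℝ ℝ, volume] (g - h)) 2 (volume.restrict S)
      ≤ ε / 3 :=
    (eLpNorm_mono_measure _ Measure.restrict_le_self).trans
      ((eLpNorm_normed_convolution_le _ (hg.sub hmem).1).trans hgh)
  have A3 : eLpNorm (h - g) 2 (volume.restrict S) ≤ ε / 3 := by
    rw [eLpNorm_sub_comm]
    exact (eLpNorm_mono_measure _ Measure.restrict_le_self).trans hgh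
  have A2 : eLpNorm (((φ k).normed volume ⋆[lsmul ℝ ℝ, volume] h) - h) 2 (volume.restrict S)
      ≤ ε / 3 := by
    refine (eLpNorm_le_of_ae_bound (C := δ) (ae_of_all _ fun x => ?_)).trans ?_
    · rw [Pi.sub_apply, ← dist_eq_norm]
      refine (φ k).dist_normed_convolution_le hc.aestronglyMeasurable fun y hy => ?_
      exact (hηh (lt_trans hy (hN k hk))).le
    · simpa using hδS
  rw [e1]
  calc _ ≤ eLpNorm ((φ k).normed volume ⋆[lsmul ℝ ℝ, volume] (g - h)) 2 (volume.restrict S) +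
        eLpNorm ((((φ k).normed volume ⋆[lsmul ℝ ℝ, volume] h) - h) + (h - g)) 2
          (volume.restrict S) :=
        eLpNorm_add_le hc1.aestronglyMeasurable
          (((hc2.sub hc).aestronglyMeasurable).add
            ((hc.aestronglyMeasurable.sub hg.1).mono_measure Measure.restrict_le_self))
          (by norm_num)
    _ ≤ ε / 3 + (ε / 3 + ε / 3) := by
        gcongr
        refine (eLpNorm_add_le (hc2.sub hc).aestronglyMeasurable
            ((hc.aestronglyMeasurable.sub hg.1).mono_measure Measure.restrict_le_self)
          (by norm_num)).trans (add_le_add A2 A3)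
    _ = ε := by rw [← add_assoc, ENNReal.add_thirds]

end SchrodingerDoubling

namespace SchrodingerDoubling

/-! ### The weight `(r² - |x - x₀|²)₊` and the weighted divergence theorem -/

/-- The weight `(r² - |x - x₀|²)₊`. -/
noncomputable def wt {n : ℕ} (x₀ : 𝔼 n) (r : ℝ) (x : 𝔼 n) : ℝ := max 0 (r ^ 2 - ‖x - x₀‖ ^ 2)

/-- The `i`-th partial derivative. -/
noncomputable def pd {n : ℕ} (i : Fin n) (v : (𝔼 n) → ℝ) (x : 𝔼 n) : ℝ :=
  fderiv ℝ v x (EuclideanSpace.single i 1)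

/-- The Laplacian, as the sum of the pure second partial derivatives. -/
noncomputable def lap {n : ℕ} (v : (𝔼 n) → ℝ) (x : 𝔼 n) : ℝ := ∑ i, pd i (pd i v) x

/-- From the exponent 2 on, a power of the positive part is differentiable across 0. This is why the
exponents of the weight are kept at least 2. -/
lemma hasDerivAt_max_zero_pow {k : ℕ} (hk : 2 ≤ k) (s : ℝ) :
    HasDerivAt (fun s : ℝ => (max 0 s) ^ k) (k * (max 0 s) ^ (k - 1)) s := by
  rcases lt_trichotomy s 0 with hs | rfl | hs
  · have : (fun s : ℝ => (max 0 s) ^ k) =ᶠ[𝓝 s] fun _ => 0 := by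
      filter_upwards [gt_mem_nhds hs] with t ht
      rw [max_eq_left ht.le, zero_pow (by omega)]
    rw [max_eq_left hs.le, zero_pow (by omega), mul_zero]
    exact (hasDerivAt_const s (0 : ℝ)).congr_of_eventuallyEq this
  · simp only [max_self, zero_pow (show k - 1 ≠ 0 by omega), mul_zero]
    rw [hasDerivAt_iff_isLittleO]
    have h1 : (fun s : ℝ => s ^ k) =o[𝓝 0] fun s : ℝ => s := by
      simpa using Asymptotics.isLittleO_pow_pow (𝕜 := ℝ) (m := 1) (n := k) (by omega)
    have h2 : (fun s : ℝ => (max 0 s) ^ k) =O[𝓝 0] fun s : ℝ => s ^ k := by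
      refine Asymptotics.IsBigO.of_bound 1 (Eventually.of_forall fun t => ?_)
      rw [one_mul, norm_pow, norm_pow]
      refine pow_le_pow_left₀ (norm_nonneg _) ?_ k
      rw [Real.norm_eq_abs, Real.norm_eq_abs, abs_of_nonneg (le_max_left _ _)]
      exact max_le (abs_nonneg _) (le_abs_self _)
    simpa [zero_pow (show k ≠ 0 by omega)] using h2.trans_isLittleO h1
  · have : (fun s : ℝ => (max 0 s) ^ k) =ᶠ[𝓝 s] fun s => s ^ k := by
      filter_upwards [lt_mem_nhds hs] with t ht
      rw [max_eq_right ht.le]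
    rw [max_eq_right hs.le]
    exact (hasDerivAt_pow k s).congr_of_eventuallyEq this

variable {n : ℕ} {x₀ : 𝔼 n} {r : ℝ}

lemma wt_nonneg (x : 𝔼 n) : 0 ≤ wt x₀ r x := le_max_left _ _

lemma wt_le (x : 𝔼 n) : wt x₀ r x ≤ r ^ 2 :=
  max_le (sq_nonneg _) (by nlinarith [sq_nonneg ‖x - x₀‖])

@[fun_prop]
lemma continuous_wt : Continuous (wt x₀ r) := by
  unfold wt; fun_prop

lemma wt_eq_zero (hr : 0 ≤ r) {x : 𝔼 n} (hx : x ∉ ball x₀ r) : wt x₀ r x = 0 := by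
  rw [mem_ball, dist_eq_norm, not_lt] at hx
  exact max_eq_left (by nlinarith [norm_nonneg (x - x₀)])

lemma hasCompactSupport_wt (hr : 0 ≤ r) {k : ℕ} (hk : k ≠ 0) :
    HasCompactSupport fun x : 𝔼 n => wt x₀ r x ^ k := by
  refine HasCompactSupport.of_support_subset_isCompact (isCompact_closedBall x₀ r) ?_
  intro x hx
  by_contra h
  refine hx ?_
  simp only
  rw [wt_eq_zero hr (fun h' => h (ball_subset_closedBall h')), zero_pow hk]

lemma pd_wt_pow {k : ℕ} (hk : 2 ≤ k) (i : Fin n) (x : 𝔼 n) :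
    DifferentiableAt ℝ (fun x => wt x₀ r x ^ k) x ∧
    pd i (fun x => wt x₀ r x ^ k) x = - (2 * k * wt x₀ r x ^ (k - 1) * (x i - x₀ i)) := by
  have h1 : HasFDerivAt (fun x : 𝔼 n => r ^ 2 - ‖x - x₀‖ ^ 2) (-(2 • (innerSL ℝ (x - x₀)))) x := by
    have h0 : HasFDerivAt (fun x : 𝔼 n => x - x₀) (ContinuousLinearMap.id ℝ _) x :=
      (hasFDerivAt_id x).sub_const x₀
    simpa using (h0.norm_sq).const_sub (r ^ 2)
  have h2 := (hasDerivAt_max_zero_pow hk (r ^ 2 - ‖x - x₀‖ ^ 2)).comp_hasFDerivAt x h1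
  refine ⟨h2.differentiableAt, ?_⟩
  have h3 : fderiv ℝ (fun x => wt x₀ r x ^ k) x = _ := h2.fderiv
  rw [pd, h3]
  simp [wt, EuclideanSpace.inner_single_right]
  ring

lemma continuous_pd {v : (𝔼 n) → ℝ} (hv : ContDiff ℝ 1 v) (i : Fin n) : Continuous (pd i v) :=
  (hv.continuous_fderiv one_ne_zero).clm_apply continuous_const

/-- The divergence theorem for the field `wᵏ X`. -/
lemma integral_wt_div {k : ℕ} (hk : 2 ≤ k) (hr : 0 ≤ r) {T : ℝ} (hrT : r ≤ T)
    {X : Fin n → (𝔼 n) → ℝ} (hX : ∀ i, ContDiff ℝ 1 (X i)) :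
    ∫ x in ball x₀ T, wt x₀ r x ^ k * ∑ i, pd i (X i) x =
      ∫ x in ball x₀ T, 2 * k * wt x₀ r x ^ (k - 1) * ∑ i, (x i - x₀ i) * X i x := by
  have hsub : ∀ x, x ∉ ball x₀ T → wt x₀ r x = 0 := fun x hx =>
    wt_eq_zero hr fun h => hx (ball_subset_ball hrT h)
  rw [setIntegral_eq_integral_of_forall_compl_eq_zero
      (fun x hx => by rw [hsub x hx, zero_pow (by omega), zero_mul]),
    setIntegral_eq_integral_of_forall_compl_eq_zero
      (fun x hx => by rw [hsub x hx, zero_pow (by omega), mul_zero, zero_mul])]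
  simp only [Finset.mul_sum]
  have I1 : ∀ (j : ℕ), j ≠ 0 → ∀ q : (𝔼 n) → ℝ, Continuous q →
      Integrable (fun x => wt x₀ r x ^ j * q x) := fun j hj q hq =>
    ((continuous_wt.pow j).mul hq).integrable_of_hasCompactSupport
      ((hasCompactSupport_wt hr hj).mul_right)
  have hpd : ∀ i x, pd i (fun x => wt x₀ r x ^ k) x =
      - (2 * k * wt x₀ r x ^ (k - 1) * (x i - x₀ i)) := fun i x => (pd_wt_pow hk i x).2
  have I2 : ∀ i, Integrable (fun x => 2 * k * wt x₀ r x ^ (k - 1) * ((x i - x₀ i) * X i x)) := by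
    intro i
    have hc := (hX i).continuous
    have := I1 (k - 1) (by omega) (fun x => 2 * k * ((x i - x₀ i) * X i x)) (by fun_prop)
    refine this.congr (ae_of_all _ fun x => by ring)
  rw [integral_finsetSum _ fun i _ => I1 k (by omega) _ (continuous_pd (hX i) i),
    integral_finsetSum _ fun i _ => I2 i]
  refine Finset.sum_congr rfl fun i _ => ?_
  have h := integral_mul_fderiv_eq_neg_fderiv_mul_of_integrable (μ := (volume : Measure (𝔼 n)))
    (f := fun x => wt x₀ r x ^ k) (g := X i) (v := EuclideanSpace.single i 1) ?_
    (I1 k (by omega) _ (continuous_pd (hX i) i)) (I1 k (by omega) _ (hX i).continuous)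
    (fun x _ => (pd_wt_pow hk i x).1) (fun x _ => (hX i).differentiable one_ne_zero x)
  · change ∫ x, wt x₀ r x ^ k * pd i (X i) x = - ∫ x, pd i (fun x => wt x₀ r x ^ k) x * X i x at h
    rw [h, ← integral_neg]
    refine integral_congr_ae (ae_of_all _ fun x => ?_)
    simp only [hpd]; ring
  · refine ((I2 i).neg).congr (ae_of_all _ fun x => ?_)
    change _ = pd i (fun x => wt x₀ r x ^ k) x * X i x
    rw [hpd]; simp only [Pi.neg_apply]; ring

lemma pd_mul {f g : (𝔼 n) → ℝ} {x : 𝔼 n} (hf : DifferentiableAt ℝ f x)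
    (hg : DifferentiableAt ℝ g x) (i : Fin n) :
    pd i (fun x => f x * g x) x = pd i f x * g x + f x * pd i g x := by
  simp only [pd]
  rw [fderiv_fun_mul hf hg]; simp; ring

lemma pd_sub {f g : (𝔼 n) → ℝ} {x : 𝔼 n} (hf : DifferentiableAt ℝ f x)
    (hg : DifferentiableAt ℝ g x) (i : Fin n) :
    pd i (fun x => f x - g x) x = pd i f x - pd i g x := by
  simp only [pd]
  rw [fderiv_fun_sub hf hg]; simp

lemma pd_sum {ι : Type*} (s : Finset ι) {f : ι → (𝔼 n) → ℝ} {x : 𝔼 n}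
    (hf : ∀ j, DifferentiableAt ℝ (f j) x) (i : Fin n) :
    pd i (fun x => ∑ j ∈ s, f j x) x = ∑ j ∈ s, pd i (f j) x := by
  simp only [pd]
  rw [fderiv_fun_sum fun j _ => hf j]; simp

lemma pd_coord (i j : Fin n) (x : 𝔼 n) :
    pd i (fun x : 𝔼 n => x j - x₀ j) x = if i = j then 1 else 0 := by
  have : HasFDerivAt (fun x : 𝔼 n => x j - x₀ j) (EuclideanSpace.proj (𝕜 := ℝ) j) x :=
    ((EuclideanSpace.proj (𝕜 := ℝ) j).hasFDerivAt).sub_const _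
  rw [pd, this.fderiv]
  simp [eq_comm]

lemma contDiff_pd {v : (𝔼 n) → ℝ} (hv : ContDiff ℝ ∞ v) (i : Fin n) : ContDiff ℝ ∞ (pd i v) :=
  (hv.fderiv_right (m := ∞) (by simp)).clm_apply contDiff_const

lemma pd_comm {v : (𝔼 n) → ℝ} (hv : ContDiff ℝ ∞ v) (i j : Fin n) (x : 𝔼 n) :
    pd i (pd j v) x = pd j (pd i v) x := by
  have hs : IsSymmSndFDerivAt ℝ v x := hv.contDiffAt.isSymmSndFDerivAt
    (by rw [minSmoothness_of_isRCLikeNormedField]; exact WithTop.coe_le_coe.2 (le_top : (2 : ℕ∞) ≤ ⊤))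
  have hd : DifferentiableAt ℝ (fderiv ℝ v) x :=
    (hv.fderiv_right (m := ∞) (by simp)).differentiable (by simp) x
  have h : ∀ i j, pd i (pd j v) x =
      fderiv ℝ (fderiv ℝ v) x (EuclideanSpace.single i 1) (EuclideanSpace.single j 1) := by
    intro i j
    have : pd j v = fun x => fderiv ℝ v x (EuclideanSpace.single j 1) := rfl
    rw [pd, this, fderiv_clm_apply hd (differentiableAt_const _)]
    simp
  rw [h, h, hs]

lemma differentiable_of_smooth {v : (𝔼 n) → ℝ} (hv : ContDiff ℝ ∞ v) (x : 𝔼 n) :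
    DifferentiableAt ℝ v x := hv.differentiable (by simp) x

lemma contDiff_coord (j : Fin n) : ContDiff ℝ ∞ (fun x : 𝔼 n => x j - x₀ j) := by
  fun_prop

/-- The divergence theorem for the field `(x - x₀) v²`; it evaluates the derivative of the weighted
height. -/
lemma smooth_radial_identity {α : ℕ} (hα : 2 ≤ α) (hr : 0 ≤ r) {T : ℝ} (hrT : r ≤ T)
    {v : (𝔼 n) → ℝ} (hv : ContDiff ℝ ∞ v) :
    ∫ x in ball x₀ T, wt x₀ r x ^ α *
        (n * v x ^ 2 + 2 * (v x * ∑ i, (x i - x₀ i) * pd i v x)) =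
      ∫ x in ball x₀ T, 2 * α * wt x₀ r x ^ (α - 1) * (‖x - x₀‖ ^ 2 * v x ^ 2) := by
  have h := integral_wt_div (x₀ := x₀) hα hr hrT (X := fun i x => (x i - x₀ i) * (v x * v x))
    fun i => ((contDiff_coord i).mul (hv.mul hv)).of_le (by simp)
  convert h using 4 with x x
  · have hd := differentiable_of_smooth hv x
    have : ∀ i, pd i (fun x => (x i - x₀ i) * (v x * v x)) x =
        v x ^ 2 + 2 * (v x * ((x i - x₀ i) * pd i v x)) := by
      intro i
      rw [pd_mul (differentiable_of_smooth (contDiff_coord i) x) (hd.fun_mul hd), pd_mul hd hd, pd_coord]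
      simp; ring
    simp only [this, Finset.sum_add_distrib, Finset.mul_sum]
    simp
  · rw [EuclideanSpace.norm_sq_eq, Finset.sum_mul]
    refine Finset.sum_congr rfl fun i _ => ?_
    simp; ring

/-- The divergence theorem for the field `v ∇v`; it trades the cross term `v (x - x₀) · ∇v` for the
Dirichlet energy. -/
lemma smooth_energy_identity {a : ℕ} (ha : 2 ≤ a) (hr : 0 ≤ r) {T : ℝ} (hrT : r ≤ T)
    {v : (𝔼 n) → ℝ} (hv : ContDiff ℝ ∞ v) :
    ∫ x in ball x₀ T, wt x₀ r x ^ a * (∑ i, pd i v x ^ 2 + v x * lap v x) =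
      ∫ x in ball x₀ T, 2 * a * wt x₀ r x ^ (a - 1) *
        (v x * ∑ i, (x i - x₀ i) * pd i v x) := by
  have h := integral_wt_div (x₀ := x₀) ha hr hrT (X := fun i x => v x * pd i v x)
    fun i => (hv.mul (contDiff_pd hv i)).of_le (by simp)
  convert h using 4 with x x
  · have : ∀ i, pd i (fun x => v x * pd i v x) x = pd i v x ^ 2 + v x * pd i (pd i v) x := by
      intro i
      rw [pd_mul (differentiable_of_smooth hv x) (differentiable_of_smooth (contDiff_pd hv i) x)]
      ring
    simp only [this, Finset.sum_add_distrib, Finset.mul_sum, lap]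
  · rw [Finset.mul_sum]
    refine Finset.sum_congr rfl fun i _ => by ring

/-- Pohozaev's identity with weight. -/
lemma smooth_pohozaev_identity {a : ℕ} (ha : 2 ≤ a) (hr : 0 ≤ r) {T : ℝ} (hrT : r ≤ T)
    {v : (𝔼 n) → ℝ} (hv : ContDiff ℝ ∞ v) :
    ∫ x in ball x₀ T, wt x₀ r x ^ a * ((2 - n) * ∑ i, pd i v x ^ 2 +
        2 * ((∑ i, (x i - x₀ i) * pd i v x) * lap v x)) =
      ∫ x in ball x₀ T, 2 * a * wt x₀ r x ^ (a - 1) *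
        (2 * (∑ i, (x i - x₀ i) * pd i v x) ^ 2 - ‖x - x₀‖ ^ 2 * ∑ i, pd i v x ^ 2) := by
  set A : (𝔼 n) → ℝ := fun x => ∑ i, (x i - x₀ i) * pd i v x with hA
  set Q : (𝔼 n) → ℝ := fun x => ∑ i, pd i v x * pd i v x with hQ
  have hg := fun i => contDiff_pd hv i
  have hAc : ContDiff ℝ ∞ A := ContDiff.sum fun i _ => (contDiff_coord i).mul (hg i)
  have hQc : ContDiff ℝ ∞ Q := ContDiff.sum fun i _ => (hg i).mul (hg i)
  have hAg : ∀ i, ContDiff ℝ ∞ (fun x => A x * pd i v x) := fun i => hAc.mul (hg i)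
  have hyQ : ∀ i, ContDiff ℝ ∞ (fun x => (x i - x₀ i) * Q x) := fun i =>
    (contDiff_coord i).mul hQc
  -- The field is `2 ((x - x₀) · ∇v) ∇v - |∇v|² (x - x₀)`. In its divergence only the Laplacian
  -- survives among the second derivatives.
  have h := integral_wt_div (x₀ := x₀) ha hr hrT
    (X := fun i x => (2 : ℝ) * (A x * pd i v x) - (x i - x₀ i) * Q x)
    fun i => ((contDiff_const.mul (hAg i)).sub (hyQ i)).of_le (by simp)
  have hQ2 : ∀ x, ∑ i, pd i v x ^ 2 = Q x := fun x => by simp only [hQ, pow_two]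
  simp only [hQ2]
  convert h using 4 with x x
  · have dA := differentiable_of_smooth hAc x
    have dQ := differentiable_of_smooth hQc x
    have dg := fun i => differentiable_of_smooth (hg i) x
    have dy := fun i => differentiable_of_smooth (contDiff_coord (x₀ := x₀) i) x
    have pA : ∀ i, pd i A x = pd i v x + ∑ j, (x j - x₀ j) * pd i (pd j v) x := by
      intro i
      rw [hA, pd_sum _ fun j => (dy j).fun_mul (dg j)]
      have : ∀ j, pd i (fun x => (x j - x₀ j) * pd j v x) x =
          (if i = j then pd j v x else 0) + (x j - x₀ j) * pd i (pd j v) x := by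
        intro j
        rw [pd_mul (dy j) (dg j), pd_coord]
        split_ifs <;> ring
      simp only [this, Finset.sum_add_distrib, Finset.sum_ite_eq, Finset.mem_univ, if_true]
    have pQ : ∀ i, pd i Q x = 2 * ∑ j, pd j v x * pd i (pd j v) x := by
      intro i
      rw [hQ, pd_sum _ fun j => (dg j).fun_mul (dg j), Finset.mul_sum]
      refine Finset.sum_congr rfl fun j _ => ?_
      rw [pd_mul (dg j) (dg j)]; ring
    have key : ∀ i, pd i (fun x => (2 : ℝ) * (A x * pd i v x) - (x i - x₀ i) * Q x) x =
        2 * (pd i v x * pd i v x) + 2 * ∑ j, pd i v x * (x j - x₀ j) * pd i (pd j v) x +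
          2 * (A x * pd i (pd i v) x) - Q x - 2 * ∑ j, (x i - x₀ i) * pd j v x * pd i (pd j v) x := by
      intro i
      rw [pd_sub ((differentiableAt_const _).fun_mul (differentiable_of_smooth (hAg i) x))
        (differentiable_of_smooth (hyQ i) x),
        pd_mul (differentiableAt_const _) (differentiable_of_smooth (hAg i) x),
        pd_mul dA (dg i), pd_mul (dy i) dQ, pA, pQ, pd_coord]
      have : pd i (fun _ => (2 : ℝ)) x = 0 := by simp [pd]
      rw [this]
      simp only [if_true, Finset.mul_sum, add_mul, Finset.sum_mul, mul_add]
      have e1 : ∀ j, 2 * ((x j - x₀ j) * pd i (pd j v) x * pd i v x) =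
        2 * (pd i v x * (x j - x₀ j) * pd i (pd j v) x) := fun j => by ring
      have e2 : ∀ j, (x i - x₀ i) * (2 * (pd j v x * pd i (pd j v) x)) =
        2 * ((x i - x₀ i) * pd j v x * pd i (pd j v) x) := fun j => by ring
      simp only [e1, e2]
      ring
    simp only [key, Finset.sum_sub_distrib, Finset.sum_add_distrib, ← Finset.mul_sum]
    -- Symmetry of the Hessian makes the two double sums equal, so they cancel.
    have sw : ∑ i, ∑ j, (x i - x₀ i) * pd j v x * pd i (pd j v) x =
        ∑ i, ∑ j, pd i v x * (x j - x₀ j) * pd i (pd j v) x := by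
      rw [Finset.sum_comm]
      refine Finset.sum_congr rfl fun j _ => Finset.sum_congr rfl fun i _ => ?_
      rw [pd_comm hv i j]; ring
    rw [sw]
    simp only [lap, hQ, Finset.sum_const, Finset.card_univ, Fintype.card_fin, nsmul_eq_mul]
    ring
  · have e : ∀ i, (x i - x₀ i) * (2 * (A x * pd i v x) - (x i - x₀ i) * Q x) =
        2 * A x * ((x i - x₀ i) * pd i v x) - (x i - x₀ i) ^ 2 * Q x := fun i => by ring
    simp only [e, Finset.sum_sub_distrib, ← Finset.mul_sum, ← Finset.sum_mul]
    rw [EuclideanSpace.norm_sq_eq]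
    simp only [PiLp.sub_apply, Real.norm_eq_abs, sq_abs]
    change _ = 2 * A x * A x - _
    ring

end SchrodingerDoubling

namespace SchrodingerDoubling

/-! ### Passing to the limit in quadratic integrals -/

/-- Convergence in `L²(ν)`. -/
structure L2Lim {X : Type*} [MeasurableSpace X] (ν : Measure X) (a : ℕ → X → ℝ) (b : X → ℝ) :
    Prop where
  memLp : ∀ k, MemLp (a k) 2 ν
  memLp_lim : MemLp b 2 ν
  tendsto : Tendsto (fun k => eLpNorm (a k - b) 2 ν) atTop (𝓝 0)

namespace L2Lim

variable {X : Type*} [MeasurableSpace X] {ν : Measure X} {a a' : ℕ → X → ℝ} {b b' : X → ℝ}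

lemma bdd_mul (h : L2Lim ν a b) {c : X → ℝ} (hc : AEStronglyMeasurable c ν) {C : ℝ}
    (hC : ∀ᵐ x ∂ν, |c x| ≤ C) : L2Lim ν (fun k x => c x * a k x) (fun x => c x * b x) := by
  have hm : ∀ q : X → ℝ, MemLp q 2 ν → MemLp (fun x => c x * q x) 2 ν := fun q hq => by
    refine hq.of_le_mul (c := C) (hc.mul hq.1) ?_
    filter_upwards [hC] with x hx
    rw [norm_mul]
    exact mul_le_mul_of_nonneg_right hx (norm_nonneg _)
  refine ⟨fun k => hm _ (h.memLp k), hm _ h.memLp_lim, ?_⟩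
  have h0 : Tendsto (fun k => ENNReal.ofReal C * eLpNorm (a k - b) 2 ν) atTop (𝓝 0) := by
    simpa using ENNReal.Tendsto.const_mul h.tendsto (Or.inr ENNReal.ofReal_ne_top)
  refine tendsto_of_tendsto_of_tendsto_of_le_of_le tendsto_const_nhds h0 (fun _ => zero_le)
    fun k => ?_
  refine eLpNorm_le_mul_eLpNorm_of_ae_le_mul ?_ 2
  filter_upwards [hC] with x hx
  simp only [Pi.sub_apply, ← mul_sub, norm_mul]
  exact mul_le_mul_of_nonneg_right hx (norm_nonneg _)

lemma sum {ι : Type*} (s : Finset ι) {a : ι → ℕ → X → ℝ} {b : ι → X → ℝ}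
    (h : ∀ i ∈ s, L2Lim ν (a i) (b i)) :
    L2Lim ν (fun k x => ∑ i ∈ s, a i k x) (fun x => ∑ i ∈ s, b i x) := by
  refine ⟨fun k => memLp_finsetSum _ fun i hi => (h i hi).memLp k,
    memLp_finsetSum _ fun i hi => (h i hi).memLp_lim, ?_⟩
  have h0 : Tendsto (fun k => ∑ i ∈ s, eLpNorm (a i k - b i) 2 ν) atTop (𝓝 0) := by
    simpa using tendsto_finsetSum s fun i hi => (h i hi).tendsto
  refine tendsto_of_tendsto_of_tendsto_of_le_of_le tendsto_const_nhds h0 (fun _ => zero_le)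
    fun k => ?_
  have e : (fun x => ∑ i ∈ s, a i k x) - (fun x => ∑ i ∈ s, b i x) = ∑ i ∈ s, (a i k - b i) := by
    ext x; simp [Finset.sum_sub_distrib]
  rw [e]
  exact eLpNorm_sum_le (fun i hi => ((h i hi).memLp k).1.sub (h i hi).memLp_lim.1) (by norm_num)

/-- The integral of a product is the inner product of `L²`, which is jointly continuous. -/
lemma tendsto_integral_mul (h : L2Lim ν a b) (h' : L2Lim ν a' b') :
    Tendsto (fun k => ∫ x, a k x * a' k x ∂ν) atTop (𝓝 (∫ x, b x * b' x ∂ν)) := by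
  have e : ∀ {p q : X → ℝ} (hp : MemLp p 2 ν) (hq : MemLp q 2 ν),
      ∫ x, p x * q x ∂ν = inner ℝ (hq.toLp q) (hp.toLp p) := by
    intro p q hp hq
    rw [L2.inner_def]
    refine integral_congr_ae ?_
    filter_upwards [hp.coeFn_toLp, hq.coeFn_toLp] with x h1 h2
    rw [h1, h2]; simp
  simp only [e (h.memLp _) (h'.memLp _), e h.memLp_lim h'.memLp_lim]
  exact (Lp.tendsto_Lp_iff_tendsto_eLpNorm'' _ h'.memLp _ h'.memLp_lim |>.2 h'.tendsto).inner
    (Lp.tendsto_Lp_iff_tendsto_eLpNorm'' _ h.memLp _ h.memLp_lim |>.2 h.tendsto)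

lemma tendsto_integral_wmul (h : L2Lim ν a b) (h' : L2Lim ν a' b') {c : X → ℝ}
    (hc : AEStronglyMeasurable c ν) {C : ℝ} (hC : ∀ᵐ x ∂ν, |c x| ≤ C) :
    Tendsto (fun k => ∫ x, c x * (a k x * a' k x) ∂ν) atTop
      (𝓝 (∫ x, c x * (b x * b' x) ∂ν)) := by
  simpa only [mul_assoc] using (h.bdd_mul hc hC).tendsto_integral_mul h'

end L2Lim

/-! ### Mollification of a weak solution -/

lemma clm_apply_eq_sum {n : ℕ} (L : (𝔼 n) →L[ℝ] ℝ) (y : 𝔼 n) :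
    L y = ∑ i, L (EuclideanSpace.single i 1) * y i := by
  conv_lhs => rw [← (EuclideanSpace.basisFun (Fin n) ℝ).sum_repr y]
  simp [mul_comm]

lemma pd_mollify {n : ℕ} (φ : ContDiffBump (0 : 𝔼 n)) {g : (𝔼 n) → ℝ}
    (hg : LocallyIntegrable g volume) (i : Fin n) (x : 𝔼 n) :
    pd i (φ.normed volume ⋆[lsmul ℝ ℝ, volume] g) x =
      ∫ t, pd i (φ.normed volume) (x - t) * g t := by
  have hφ : ContDiff ℝ 1 (φ.normed volume) := φ.contDiff_normed
  have hcs := φ.hasCompactSupport_normed (μ := (volume : Measure (𝔼 n)))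
  rw [pd, ← convolution_flip, (hcs.hasFDerivAt_convolution_right _ hg hφ x).fderiv,
    convolution_precompR_apply _ hg (hcs.fderiv ℝ) (hφ.continuous_fderiv one_ne_zero),
    convolution_def]
  refine integral_congr_ae (ae_of_all _ fun t => ?_)
  simp [pd, mul_comm]

section approx

variable {n : ℕ} {x₀ : 𝔼 n} {T T' : ℝ} {Ω : Set (𝔼 n)}

lemma integral_indicator_conv (hΩ : MeasurableSet Ω) {S : Set (𝔼 n)} (hS : S ⊆ Ω)
    {ψ : (𝔼 n) → ℝ} (q : (𝔼 n) → ℝ) {x : 𝔼 n} (h : ∀ t, t ∉ S → ψ (x - t) = 0) :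
    ∫ t, ψ (x - t) * S.indicator q t = ∫ t in Ω, ψ (x - t) * q t := by
  rw [← integral_indicator hΩ]
  refine integral_congr_ae (ae_of_all _ fun t => ?_)
  by_cases ht : t ∈ S
  · simp [ht, hS ht]
  · simp [ht, h t ht, indicator]

/-- For `x` in the smaller ball, the translated mollifier is an admissible test function. The weak
formulations therefore identify the gradient and Laplacian of the mollified `u` with the
mollifications of `G` and `f`, and these converge in `L²`. -/
lemma exists_smooth_approx {G : (𝔼 n) → (𝔼 n)} {u : (𝔼 n) → ℝ} (hΩ : MeasurableSet Ω)
    (hTT' : T < T') (hsub : closedBall x₀ T' ⊆ Ω)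
    (hw : HasWeakFDerivOn Ω u (fun x => innerSL ℝ (G x)))
    (hu2 : MemLp u 2 (volume.restrict (closedBall x₀ T')))
    (hG2 : MemLp G 2 (volume.restrict (closedBall x₀ T')))
    {f : (𝔼 n) → ℝ} (hf2 : MemLp f 2 (volume.restrict (closedBall x₀ T')))
    (ht : ∀ φ : (𝔼 n) → ℝ, ContDiff ℝ ∞ φ → HasCompactSupport φ → tsupport φ ⊆ Ω →
      - ∫ x in Ω, fderiv ℝ φ x (G x) = ∫ x in Ω, f x * φ x) :
    ∃ v : ℕ → (𝔼 n) → ℝ, (∀ k, ContDiff ℝ ∞ (v k)) ∧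
      L2Lim (volume.restrict (ball x₀ T)) v u ∧
      (∀ i, L2Lim (volume.restrict (ball x₀ T)) (fun k => pd i (v k)) (fun x => G x i)) ∧
      L2Lim (volume.restrict (ball x₀ T)) (fun k => lap (v k)) f := by
  set S := closedBall x₀ T' with hSdef
  have hSm : MeasurableSet S := measurableSet_closedBall
  have hδ : 0 < T' - T := sub_pos.2 hTT'
  -- The radii never exceed `T' - T`, so from the ball of radius `T` the mollifier does not see the
  -- truncation of `u` outside `S`.
  let φ : ℕ → ContDiffBump (0 : 𝔼 n) := fun k =>
    ⟨(T' - T) / (k + 1) / 2, (T' - T) / (k + 1), by positivity, half_lt_self (by positivity)⟩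
  have hφ : Tendsto (fun k => (φ k).rOut) atTop (𝓝 0) := by
    simpa [φ, div_eq_mul_inv] using
      (tendsto_one_div_add_atTop_nhds_zero_nat (𝕜 := ℝ)).const_mul (T' - T)
  have hφle : ∀ k, (φ k).rOut ≤ T' - T := fun k => by
    simp only [φ]
    exact div_le_self hδ.le (by linarith [Nat.cast_nonneg (α := ℝ) k])
  have hGi2 : ∀ i, MemLp (fun x => G x i) 2 (volume.restrict S) := fun i =>
    hG2.of_le ((EuclideanSpace.proj (𝕜 := ℝ) i).continuous.comp_aestronglyMeasurable hG2.1)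
      (ae_of_all _ fun x => PiLp.norm_apply_le _ _)
  have hind : ∀ q : (𝔼 n) → ℝ, MemLp q 2 (volume.restrict S) → MemLp (S.indicator q) 2 volume :=
    fun q hq => (memLp_indicator_iff_restrict hSm).2 hq
  have hloc : ∀ q : (𝔼 n) → ℝ, MemLp q 2 (volume.restrict S) →
      LocallyIntegrable (S.indicator q) volume := fun q hq =>
    (hind q hq).locallyIntegrable (by norm_num)
  let η : ℕ → (𝔼 n) → ℝ := fun k => (φ k).normed volume
  have hηs : ∀ k, ContDiff ℝ ∞ (η k) := fun k => (φ k).contDiff_normed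
  have hηc : ∀ k, HasCompactSupport (η k) := fun k => (φ k).hasCompactSupport_normed
  have hball : ball x₀ T ⊆ S := ball_subset_closedBall.trans (closedBall_subset_closedBall hTT'.le)
  have hout : ∀ k, ∀ x ∈ ball x₀ T, ∀ t, t ∉ S → x - t ∉ tsupport (η k) := by
    intro k x hx t htS hmem
    rw [(φ k).tsupport_normed_eq, mem_closedBall_zero_iff] at hmem
    refine htS ?_
    rw [hSdef, mem_closedBall]
    have h1 := mem_ball.1 hx
    have h2 := dist_triangle t x x₀
    rw [dist_comm t x, dist_eq_norm x t] at h2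
    linarith [hφle k]
  have hη0 : ∀ k, ∀ x ∈ ball x₀ T, ∀ t, t ∉ S → η k (x - t) = 0 := fun k x hx t htS =>
    image_eq_zero_of_notMem_tsupport (hout k x hx t htS)
  have hηd0 : ∀ k i, ∀ x ∈ ball x₀ T, ∀ t, t ∉ S → pd i (η k) (x - t) = 0 :=
    fun k i x hx t htS => by
      have : fderiv ℝ (η k) (x - t) = 0 := by
        by_contra h
        exact hout k x hx t htS (support_fderiv_subset ℝ h)
      simp [pd, this]
  have htest : ∀ k, ∀ x ∈ ball x₀ T, ContDiff ℝ ∞ (fun t => η k (x - t)) ∧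
      HasCompactSupport (fun t => η k (x - t)) ∧ tsupport (fun t => η k (x - t)) ⊆ Ω := by
    intro k x hx
    have hs : tsupport (fun t => η k (x - t)) ⊆ S := by
      refine closure_minimal (fun t h => ?_) isClosed_closedBall
      by_contra h'
      exact h (hη0 k x hx t h')
    exact ⟨(hηs k).comp (contDiff_const.sub contDiff_id),
      HasCompactSupport.of_support_subset_isCompact (isCompact_closedBall x₀ T')
        ((subset_tsupport _).trans hs), hs.trans hsub⟩
  have hfd : ∀ k x t y, fderiv ℝ (fun t => η k (x - t)) t y = - fderiv ℝ (η k) (x - t) y := by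
    intro k x t y
    have h1 : HasFDerivAt (fun t : 𝔼 n => x - t) (-(ContinuousLinearMap.id ℝ _)) t := by
      simpa using (hasFDerivAt_id t).const_sub x
    have h2 : HasFDerivAt (η k) (fderiv ℝ (η k) (x - t)) (x - t) :=
      (differentiable_of_smooth (hηs k) _).hasFDerivAt
    have h3 : HasFDerivAt (fun t => η k (x - t)) _ t := h2.comp t h1
    rw [h3.fderiv]; simp
  have hm : ∀ k (q : (𝔼 n) → ℝ) x, ((φ k).normed volume ⋆[lsmul ℝ ℝ, volume] S.indicator q) x =
      ∫ t, η k (x - t) * S.indicator q t := fun k q x => by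
    rw [convolution_eq_swap]; rfl
  let v : ℕ → (𝔼 n) → ℝ := fun k => (φ k).normed volume ⋆[lsmul ℝ ℝ, volume] S.indicator u
  have hv : ∀ k, ContDiff ℝ ∞ (v k) := fun k =>
    (hηc k).contDiff_convolution_left _ (hηs k) (hloc u hu2)
  have hv1 : ∀ k i, ∀ x ∈ ball x₀ T, pd i (v k) x =
      ((φ k).normed volume ⋆[lsmul ℝ ℝ, volume] S.indicator (fun x => G x i)) x := by
    intro k i x hx
    obtain ⟨t1, t2, t3⟩ := htest k x hx
    have h := hw.2.2 _ t1 t2 t3 (EuclideanSpace.single i 1)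
    rw [pd_mollify _ (hloc u hu2), hm, integral_indicator_conv hΩ hsub _ (hηd0 k i x hx),
      integral_indicator_conv hΩ hsub _ (hη0 k x hx)]
    simp only [hfd, smul_eq_mul, neg_mul, integral_neg, neg_inj] at h
    simp only [innerSL_apply_apply, EuclideanSpace.inner_single_right] at h
    simpa [pd] using h
  have hv2 : ∀ k, ∀ x ∈ ball x₀ T, lap (v k) x =
      ((φ k).normed volume ⋆[lsmul ℝ ℝ, volume] S.indicator f) x := by
    intro k x hx
    have e1 : ∀ i, pd i (pd i (v k)) x = ∫ t, pd i (η k) (x - t) * S.indicator (fun x => G x i) t := by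
      intro i
      rw [← pd_mollify _ (hloc _ (hGi2 i))]
      have : pd i (v k) =ᶠ[𝓝 x]
          ((φ k).normed volume ⋆[lsmul ℝ ℝ, volume] S.indicator (fun x => G x i)) := by
        filter_upwards [isOpen_ball.mem_nhds hx] with y hy using hv1 k i y hy
      rw [pd, this.fderiv_eq]; rfl
    obtain ⟨t1, t2, t3⟩ := htest k x hx
    have h := ht _ t1 t2 t3
    have hI : ∀ i, Integrable (fun t => pd i (η k) (x - t) * S.indicator (fun x => G x i) t) := by
      intro i
      have hcs : HasCompactSupport (pd i (η k)) := (hηc k).fderiv_apply ℝ _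
      have := (hcs.convolutionExists_left (lsmul ℝ ℝ)
        (continuous_pd ((hηs k).of_le (by simp)) i) (hloc _ (hGi2 i)) x).integrable_swap
      exact this
    rw [lap, Finset.sum_congr rfl fun i _ => e1 i, ← integral_finsetSum _ fun i _ => hI i, hm,
      integral_indicator_conv hΩ hsub _ (hη0 k x hx)]
    simp only [hfd, integral_neg, neg_neg] at h
    rw [show ∫ t in Ω, η k (x - t) * f t = ∫ t in Ω, f t * η k (x - t) by simp only [mul_comm],
      ← h, ← integral_indicator hΩ]
    refine integral_congr_ae (ae_of_all _ fun t => ?_)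
    by_cases htS : t ∈ S
    · simp only [htS, hsub htS, indicator_of_mem]
      rw [clm_apply_eq_sum]; rfl
    · have h0 : fderiv ℝ (η k) (x - t) = 0 := by
        by_contra h
        exact hout k x hx t htS (support_fderiv_subset ℝ h)
      simp [htS, h0, indicator]
  have hlim : ∀ q : (𝔼 n) → ℝ, MemLp q 2 (volume.restrict S) → ∀ p : ℕ → (𝔼 n) → ℝ,
      (∀ k, Continuous (p k)) → (∀ k, ∀ x ∈ ball x₀ T, p k x =
        ((φ k).normed volume ⋆[lsmul ℝ ℝ, volume] S.indicator q) x) →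
      L2Lim (volume.restrict (ball x₀ T)) p q := by
    intro q hq p hp hpq
    refine ⟨fun k => ?_, hq.mono_measure (Measure.restrict_mono hball le_rfl), ?_⟩
    · obtain ⟨C, hC⟩ := (isCompact_closedBall x₀ T).exists_bound_of_continuousOn (hp k).continuousOn
      have : IsFiniteMeasure (volume.restrict (ball x₀ T)) := ⟨by simp [measure_ball_lt_top]⟩
      refine MemLp.of_bound (hp k).aestronglyMeasurable C ?_
      filter_upwards [ae_restrict_mem measurableSet_ball] with x hx
        using hC x (ball_subset_closedBall hx)
    · have h := tendsto_eLpNorm_mollify_sub hφ (hind q hq) (S := ball x₀ T)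
        measure_ball_lt_top.ne
      refine h.congr fun k => eLpNorm_congr_ae ?_
      filter_upwards [ae_restrict_mem measurableSet_ball] with x hx
      simp [hpq k x hx, hball hx]
  refine ⟨v, hv, hlim u hu2 v (fun k => (hv k).continuous) fun _ _ _ => rfl, fun i =>
    hlim _ (hGi2 i) _ (fun k => (contDiff_pd (hv k) i).continuous) fun k x hx => hv1 k i x hx,
    hlim f hf2 _ (fun k => ?_) hv2⟩
  exact continuous_finsetSum _ fun i _ => (contDiff_pd (contDiff_pd (hv k) i) i).continuous

end approx

end SchrodingerDoubling

/-! ### Limits of integrals of quadratic expressions. -/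

namespace SchrodingerDoubling

/-- Integrability together with convergence of the integrals. -/
structure IntLim {X : Type*} [MeasurableSpace X] (ν : Measure X) (a : ℕ → X → ℝ) (b : X → ℝ) :
    Prop where
  integrable : ∀ k, Integrable (a k) ν
  integrable_lim : Integrable b ν
  tendsto : Tendsto (fun k => ∫ x, a k x ∂ν) atTop (𝓝 (∫ x, b x ∂ν))

namespace IntLim

variable {X : Type*} [MeasurableSpace X] {ν : Measure X} {a a' : ℕ → X → ℝ} {b b' : X → ℝ}

lemma add (h : IntLim ν a b) (h' : IntLim ν a' b') :
    IntLim ν (fun k x => a k x + a' k x) (fun x => b x + b' x) := by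
  refine ⟨fun k => (h.integrable k).add (h'.integrable k), h.integrable_lim.add h'.integrable_lim, ?_⟩
  rw [integral_add h.integrable_lim h'.integrable_lim]
  simp only [integral_add (h.integrable _) (h'.integrable _)]
  exact h.tendsto.add h'.tendsto

lemma const_mul (h : IntLim ν a b) (c : ℝ) :
    IntLim ν (fun k x => c * a k x) (fun x => c * b x) := by
  refine ⟨fun k => (h.integrable k).const_mul c, h.integrable_lim.const_mul c, ?_⟩
  simp only [integral_const_mul]
  exact h.tendsto.const_mul c

lemma sum {ι : Type*} (s : Finset ι) {a : ι → ℕ → X → ℝ} {b : ι → X → ℝ}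
    (h : ∀ i, IntLim ν (a i) (b i)) :
    IntLim ν (fun k x => ∑ i ∈ s, a i k x) (fun x => ∑ i ∈ s, b i x) := by
  refine ⟨fun k => integrable_finsetSum _ fun i _ => (h i).integrable k,
    integrable_finsetSum _ fun i _ => (h i).integrable_lim, ?_⟩
  rw [integral_finsetSum _ fun i _ => (h i).integrable_lim]
  simp only [fun k => integral_finsetSum s fun i _ => (h i).integrable k]
  exact tendsto_finsetSum s fun i _ => (h i).tendsto

lemma congr (h : IntLim ν a b) (ha : ∀ k x, a' k x = a k x) (hb : ∀ x, b' x = b x) :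
    IntLim ν a' b' := by
  obtain rfl : a' = a := by ext; apply ha
  obtain rfl : b' = b := by ext; apply hb
  exact h

lemma unique (h : IntLim ν a b) (h' : IntLim ν a' b')
    (he : ∀ k, ∫ x, a k x ∂ν = ∫ x, a' k x ∂ν) : ∫ x, b x ∂ν = ∫ x, b' x ∂ν :=
  tendsto_nhds_unique h.tendsto (by simpa only [he] using h'.tendsto)

end IntLim

lemma L2Lim.intLim_wmul {X : Type*} [MeasurableSpace X] {ν : Measure X} {a a' : ℕ → X → ℝ}
    {b b' : X → ℝ} (h : L2Lim ν a b) (h' : L2Lim ν a' b') {c : X → ℝ}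
    (hc : AEStronglyMeasurable c ν) {C : ℝ} (hC : ∀ᵐ x ∂ν, |c x| ≤ C) :
    IntLim ν (fun k x => c x * (a k x * a' k x)) (fun x => c x * (b x * b' x)) := by
  have H := h.bdd_mul hc hC
  refine ⟨fun k => ?_, ?_, h.tendsto_integral_wmul h' hc hC⟩
  · exact ((H.memLp k).integrable_mul (h'.memLp k)).congr (ae_of_all _ fun x => mul_assoc _ _ _)
  · exact (H.memLp_lim.integrable_mul h'.memLp_lim).congr (ae_of_all _ fun x => mul_assoc _ _ _)

/-! ### The three integral identities for `L²` limits of smooth functions. -/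

variable {n : ℕ} {x₀ : 𝔼 n} {T : ℝ}

/-- The function `u` with gradient `G` and Laplacian `f` on `ball x₀ T` in the sense that all three
are `L²` limits of the corresponding quantities of smooth functions. -/
def IsSmoothLimit (x₀ : 𝔼 n) (T : ℝ) (u : (𝔼 n) → ℝ) (G : (𝔼 n) → (𝔼 n)) (f : (𝔼 n) → ℝ) : Prop :=
  ∃ v : ℕ → (𝔼 n) → ℝ, (∀ k, ContDiff ℝ ∞ (v k)) ∧
    L2Lim (volume.restrict (ball x₀ T)) v u ∧
    (∀ i, L2Lim (volume.restrict (ball x₀ T)) (fun k => pd i (v k)) (fun x => G x i)) ∧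
    L2Lim (volume.restrict (ball x₀ T)) (fun k => lap (v k)) f

/-- The radial derivative `(x - x₀) · G`. -/
noncomputable def rad (x₀ : 𝔼 n) (G : (𝔼 n) → (𝔼 n)) (x : 𝔼 n) : ℝ := ∑ i, (x i - x₀ i) * G x i

lemma bound_continuous_on_ball {c : (𝔼 n) → ℝ} (hc : Continuous c) :
    ∃ C, ∀ᵐ x ∂(volume.restrict (ball x₀ T)), |c x| ≤ C := by
  obtain ⟨C, hC⟩ := (isCompact_closedBall x₀ T).exists_bound_of_continuousOn hc.continuousOn
  refine ⟨C, ?_⟩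
  filter_upwards [ae_restrict_mem measurableSet_ball] with x hx using
    hC x (ball_subset_closedBall hx)

lemma L2Lim.cmul {a : ℕ → (𝔼 n) → ℝ} {b : (𝔼 n) → ℝ} (h : L2Lim (volume.restrict (ball x₀ T)) a b)
    {c : (𝔼 n) → ℝ} (hc : Continuous c) :
    L2Lim (volume.restrict (ball x₀ T)) (fun k x => c x * a k x) (fun x => c x * b x) := by
  obtain ⟨C, hC⟩ := bound_continuous_on_ball (x₀ := x₀) (T := T) hc
  exact h.bdd_mul hc.aestronglyMeasurable hC

lemma L2Lim.intLim {a a' : ℕ → (𝔼 n) → ℝ} {b b' : (𝔼 n) → ℝ}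
    (h : L2Lim (volume.restrict (ball x₀ T)) a b) (h' : L2Lim (volume.restrict (ball x₀ T)) a' b')
    {c : (𝔼 n) → ℝ} (hc : Continuous c) :
    IntLim (volume.restrict (ball x₀ T)) (fun k x => c x * (a k x * a' k x))
      (fun x => c x * (b x * b' x)) := by
  obtain ⟨C, hC⟩ := bound_continuous_on_ball (x₀ := x₀) (T := T) hc
  exact h.intLim_wmul h' hc.aestronglyMeasurable hC

lemma L2Lim.rad {v : ℕ → (𝔼 n) → ℝ} {G : (𝔼 n) → (𝔼 n)}
    (h : ∀ i, L2Lim (volume.restrict (ball x₀ T)) (fun k => pd i (v k)) (fun x => G x i)) :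
    L2Lim (volume.restrict (ball x₀ T)) (fun k x => ∑ i, (x i - x₀ i) * pd i (v k) x)
      (rad x₀ G) :=
  L2Lim.sum _ fun i _ => (h i).cmul (contDiff_coord i).continuous

lemma continuous_normsq : Continuous fun x : 𝔼 n => ‖x - x₀‖ ^ 2 := by fun_prop

variable {u f : (𝔼 n) → ℝ} {G : (𝔼 n) → (𝔼 n)} {r : ℝ}

lemma radial_identity (hs : IsSmoothLimit x₀ T u G f) {α : ℕ} (hα : 2 ≤ α) (hr : 0 ≤ r)
    (hrT : r ≤ T) :
    ∫ x in ball x₀ T, wt x₀ r x ^ α * (n * u x ^ 2 + 2 * (u x * rad x₀ G x)) =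
      ∫ x in ball x₀ T, 2 * α * wt x₀ r x ^ (α - 1) * (‖x - x₀‖ ^ 2 * u x ^ 2) := by
  obtain ⟨v, hv, h1, h2, h3⟩ := hs
  have hw : ∀ k, Continuous fun x : 𝔼 n => wt x₀ r x ^ k := fun k => continuous_wt.pow k
  have hA := L2Lim.rad h2
  refine IntLim.unique
    ((((h1.intLim h1 (hw α)).const_mul n).add ((h1.intLim hA (hw α)).const_mul 2)).congr ?_ ?_)
    ((h1.intLim h1 ((hw (α - 1)).fun_mul (continuous_normsq (x₀ := x₀)))).const_mul (2 * α) |>.congr ?_ ?_)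
    fun k => smooth_radial_identity hα hr hrT (hv k)
  all_goals intros; ring

lemma energy_identity (hs : IsSmoothLimit x₀ T u G f) {a : ℕ} (ha : 2 ≤ a) (hr : 0 ≤ r)
    (hrT : r ≤ T) :
    ∫ x in ball x₀ T, wt x₀ r x ^ a * (∑ i, G x i ^ 2 + u x * f x) =
      ∫ x in ball x₀ T, 2 * a * wt x₀ r x ^ (a - 1) * (u x * rad x₀ G x) := by
  obtain ⟨v, hv, h1, h2, h3⟩ := hs
  have hw : ∀ k, Continuous fun x : 𝔼 n => wt x₀ r x ^ k := fun k => continuous_wt.pow k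
  have hA := L2Lim.rad h2
  refine IntLim.unique
    (((IntLim.sum Finset.univ fun i => (h2 i).intLim (h2 i) (hw a)).add
      (h1.intLim h3 (hw a))).congr ?_ ?_)
    ((h1.intLim hA (hw (a - 1))).const_mul (2 * a) |>.congr ?_ ?_)
    fun k => smooth_energy_identity ha hr hrT (hv k)
  · intro k x; rw [mul_add, Finset.mul_sum]; simp only [pow_two]
  · intro x; rw [mul_add, Finset.mul_sum]; simp only [pow_two]
  all_goals intros; ring

lemma pohozaev_identity (hs : IsSmoothLimit x₀ T u G f) {a : ℕ} (ha : 2 ≤ a) (hr : 0 ≤ r)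
    (hrT : r ≤ T) :
    ∫ x in ball x₀ T, wt x₀ r x ^ a * ((2 - n) * ∑ i, G x i ^ 2 + 2 * (rad x₀ G x * f x)) =
      ∫ x in ball x₀ T, 2 * a * wt x₀ r x ^ (a - 1) *
        (2 * rad x₀ G x ^ 2 - ‖x - x₀‖ ^ 2 * ∑ i, G x i ^ 2) := by
  obtain ⟨v, hv, h1, h2, h3⟩ := hs
  have hw : ∀ k, Continuous fun x : 𝔼 n => wt x₀ r x ^ k := fun k => continuous_wt.pow k
  have hA := L2Lim.rad h2
  refine IntLim.unique
    (((IntLim.sum Finset.univ fun i => (h2 i).intLim (h2 i) (hw a)).const_mul (2 - n)).add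
      ((hA.intLim h3 (hw a)).const_mul 2) |>.congr ?_ ?_)
    (((hA.intLim hA (hw (a - 1))).const_mul (4 * a)).add
      ((IntLim.sum Finset.univ fun i => (h2 i).intLim (h2 i)
        ((hw (a - 1)).fun_mul (continuous_normsq (x₀ := x₀)))).const_mul (- (2 * a))) |>.congr ?_ ?_)
    fun k => smooth_pohozaev_identity ha hr hrT (hv k)
  all_goals intros; simp only [← Finset.mul_sum, ← pow_two]; ring

lemma IsSmoothLimit.memLp (hs : IsSmoothLimit x₀ T u G f) :
    MemLp u 2 (volume.restrict (ball x₀ T)) ∧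
    (∀ i, MemLp (fun x => G x i) 2 (volume.restrict (ball x₀ T))) ∧
    MemLp (rad x₀ G) 2 (volume.restrict (ball x₀ T)) ∧
    MemLp f 2 (volume.restrict (ball x₀ T)) := by
  obtain ⟨v, hv, h1, h2, h3⟩ := hs
  exact ⟨h1.memLp_lim, fun i => (h2 i).memLp_lim, (L2Lim.rad h2).memLp_lim, h3.memLp_lim⟩

/-! ### Differentiation of weighted integrals in the radius -/

lemma integrable_wt_mul {q : (𝔼 n) → ℝ} (hq : Integrable q (volume.restrict (ball x₀ T))) (k : ℕ)
    (r : ℝ) : Integrable (fun x => wt x₀ r x ^ k * q x) (volume.restrict (ball x₀ T)) := by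
  refine hq.bdd_mul (c := (r ^ 2) ^ k) (continuous_wt.pow k).aestronglyMeasurable
    (ae_of_all _ fun x => ?_)
  rw [Real.norm_of_nonneg (pow_nonneg (wt_nonneg x) k)]
  exact pow_le_pow_left₀ (wt_nonneg x) (wt_le x) k

/-- Differentiation under the integral sign: for radii within 1 of `r` the weight is at most `(|r| +
1)²`, which gives the dominating function. No boundary term arises because the weight vanishes at
the edge of its support. -/
lemma hasDerivAt_integral_wt {q : (𝔼 n) → ℝ} (hq : Integrable q (volume.restrict (ball x₀ T)))
    {k : ℕ} (hk : 2 ≤ k) (r : ℝ) :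
    HasDerivAt (fun r => ∫ x in ball x₀ T, wt x₀ r x ^ k * q x)
      (∫ x in ball x₀ T, 2 * k * r * (wt x₀ r x ^ (k - 1) * q x)) r := by
  have hd : ∀ x r, HasDerivAt (fun r => wt x₀ r x ^ k * q x)
      (2 * k * r * (wt x₀ r x ^ (k - 1) * q x)) r := by
    intro x r
    have h1 : HasDerivAt (fun r : ℝ => r ^ 2 - ‖x - x₀‖ ^ 2) (2 * r) r := by
      simpa using (hasDerivAt_pow 2 r).sub_const (‖x - x₀‖ ^ 2)
    have h2 := ((hasDerivAt_max_zero_pow hk (r ^ 2 - ‖x - x₀‖ ^ 2)).comp r h1).mul_const (q x)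
    refine h2.congr_deriv ?_
    simp only [wt]; ring
  refine (hasDerivAt_integral_of_dominated_loc_of_deriv_le (μ := volume.restrict (ball x₀ T))
    (F := fun r x => wt x₀ r x ^ k * q x)
    (F' := fun r x => 2 * k * r * (wt x₀ r x ^ (k - 1) * q x))
    (bound := fun x => 2 * k * (|r| + 1) * (((|r| + 1) ^ 2) ^ (k - 1) * |q x|))
    (ball_mem_nhds r one_pos) ?_ (integrable_wt_mul hq k r) ?_ ?_ ?_ ?_).2
  · exact Eventually.of_forall fun s => (integrable_wt_mul hq k s).aestronglyMeasurable
  · exact ((integrable_wt_mul hq (k - 1) r).const_mul _).aestronglyMeasurable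
  · refine ae_of_all _ fun x s hs => ?_
    have hs' : |s| ≤ |r| + 1 := by
      rw [mem_ball, Real.dist_eq] at hs
      have := abs_sub_abs_le_abs_sub s r
      linarith
    have hw : wt x₀ s x ≤ (|r| + 1) ^ 2 :=
      (wt_le x).trans (by rw [← sq_abs]; exact pow_le_pow_left₀ (abs_nonneg _) hs' 2)
    rw [norm_mul, norm_mul, norm_mul, norm_mul, norm_pow, Real.norm_of_nonneg (wt_nonneg x)]
    simp only [Real.norm_eq_abs, Nat.abs_cast, abs_two]
    have := wt_nonneg (x₀ := x₀) (r := s) x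
    gcongr
  · exact (hq.abs.const_mul _).const_mul _
  · exact ae_of_all _ fun x s _ => hd x s

/-- Where the weight is positive, `r² = w + |x - x₀|²`; elsewhere both sides vanish because `k - 1 ≥
1`. It brings `r` times a derivative in `r` to the form in which the divergence identities apply. -/
lemma wt_pow_mul_sq {k : ℕ} (hk : 2 ≤ k) (x : 𝔼 n) :
    wt x₀ r x ^ (k - 1) * r ^ 2 = wt x₀ r x ^ k + wt x₀ r x ^ (k - 1) * ‖x - x₀‖ ^ 2 := by
  obtain ⟨j, rfl⟩ : ∃ j, k = j + 2 := ⟨k - 2, by omega⟩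
  simp only [show j + 2 - 1 = j + 1 by omega]
  rcases le_total (r ^ 2 - ‖x - x₀‖ ^ 2) 0 with h | h
  · simp [wt, max_eq_left h]
  · simp only [wt, max_eq_right h]; ring

end SchrodingerDoubling

namespace SchrodingerDoubling

/-! ### The frequency function -/

/-- The weighted integral `∫ (r² - |x - x₀|²)₊ᵏ q` over `ball x₀ T`. -/
noncomputable def wint {n : ℕ} (x₀ : 𝔼 n) (T : ℝ) (k : ℕ) (q : (𝔼 n) → ℝ) (r : ℝ) : ℝ :=
  ∫ x in ball x₀ T, wt x₀ r x ^ k * q x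

variable {n : ℕ} {x₀ : 𝔼 n} {T r : ℝ} {u f : (𝔼 n) → ℝ} {G : (𝔼 n) → (𝔼 n)}

lemma wint_nonneg {q : (𝔼 n) → ℝ} (hq : ∀ x, 0 ≤ q x) (k : ℕ) (r : ℝ) : 0 ≤ wint x₀ T k q r :=
  integral_nonneg fun x => mul_nonneg (pow_nonneg (wt_nonneg x) _) (hq x)

lemma wint_add {p q : (𝔼 n) → ℝ} (hp : Integrable p (volume.restrict (ball x₀ T)))
    (hq : Integrable q (volume.restrict (ball x₀ T))) (k : ℕ) (r : ℝ) :
    wint x₀ T k (fun x => p x + q x) r = wint x₀ T k p r + wint x₀ T k q r := by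
  simp only [wint, mul_add]
  exact integral_add (integrable_wt_mul hp k r) (integrable_wt_mul hq k r)

lemma wint_const_mul (c : ℝ) (q : (𝔼 n) → ℝ) (k : ℕ) (r : ℝ) :
    wint x₀ T k (fun x => c * q x) r = c * wint x₀ T k q r := by
  simp only [wint, ← integral_const_mul]
  exact integral_congr_ae (ae_of_all _ fun x => by ring)

lemma wint_mono {p q : (𝔼 n) → ℝ} (hp : Integrable p (volume.restrict (ball x₀ T)))
    (hq : Integrable q (volume.restrict (ball x₀ T)))
    (h : ∀ᵐ x ∂(volume.restrict (ball x₀ T)), p x ≤ q x) (k : ℕ) (r : ℝ) :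
    wint x₀ T k p r ≤ wint x₀ T k q r := by
  refine integral_mono_ae (integrable_wt_mul hp k r) (integrable_wt_mul hq k r) ?_
  filter_upwards [h] with x hx
  exact mul_le_mul_of_nonneg_left hx (pow_nonneg (wt_nonneg x) _)

lemma wint_succ_le {q : (𝔼 n) → ℝ} (hq : Integrable q (volume.restrict (ball x₀ T)))
    (h : ∀ x, 0 ≤ q x) (k : ℕ) (r : ℝ) :
    wint x₀ T (k + 1) q r ≤ r ^ 2 * wint x₀ T k q r := by
  rw [wint, wint, ← integral_const_mul]
  refine integral_mono (integrable_wt_mul hq _ r) ((integrable_wt_mul hq k r).const_mul _) fun x => ?_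
  have h1 := mul_nonneg (pow_nonneg (wt_nonneg (x₀ := x₀) (r := r) x) k) (h x)
  have h2 := mul_le_mul_of_nonneg_right (wt_le (x₀ := x₀) (r := r) x) h1
  calc _ = wt x₀ r x * (wt x₀ r x ^ k * q x) := by ring
    _ ≤ _ := h2

/-- `r` times the derivative of a weighted integral. -/
lemma hasDerivAt_wint {q : (𝔼 n) → ℝ} (hq : Integrable q (volume.restrict (ball x₀ T)))
    {k : ℕ} (hk : 2 ≤ k) (r : ℝ) :
    ∃ w', HasDerivAt (wint x₀ T k q) w' r ∧ r * w' = 2 * k * wint x₀ T k q r +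
      2 * k * ∫ x in ball x₀ T, wt x₀ r x ^ (k - 1) * (‖x - x₀‖ ^ 2 * q x) := by
  refine ⟨_, hasDerivAt_integral_wt hq hk r, ?_⟩
  have hi : Integrable (fun x => wt x₀ r x ^ (k - 1) * (‖x - x₀‖ ^ 2 * q x))
      (volume.restrict (ball x₀ T)) := by
    refine integrable_wt_mul ?_ _ _
    obtain ⟨C, hC⟩ := bound_continuous_on_ball (x₀ := x₀) (T := T) (continuous_normsq (x₀ := x₀))
    exact hq.bdd_mul (continuous_normsq (x₀ := x₀)).aestronglyMeasurable hC
  rw [wint, ← mul_add, ← integral_add (integrable_wt_mul hq k r) hi, ← integral_const_mul,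
    ← integral_const_mul]
  refine integral_congr_ae (ae_of_all _ fun x => ?_)
  have := wt_pow_mul_sq (x₀ := x₀) (r := r) hk x
  calc _ = 2 * k * (wt x₀ r x ^ (k - 1) * r ^ 2) * q x := by ring
    _ = _ := by rw [this]; ring

/-- The differential inequalities for the weighted height `h` and the weighted Dirichlet
energy `d`. -/
theorem frequency_inequalities (hs : IsSmoothLimit x₀ T u G f)
    (hf : ∀ᵐ x ∂(volume.restrict (ball x₀ T)), |f x| ≤ ‖G x‖ + |u x|)
    {α : ℕ} (hα : 2 ≤ α) (hr : 0 < r) (hrT : r ≤ T) :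
    ∃ h' d', HasDerivAt (wint x₀ T α fun x => u x ^ 2) h' r ∧
      HasDerivAt (wint x₀ T (α + 1) fun x => ‖G x‖ ^ 2) d' r ∧
      |((α : ℝ) + 1) * (r * h' - (2 * α + n) * wint x₀ T α (fun x => u x ^ 2) r) -
          wint x₀ T (α + 1) (fun x => ‖G x‖ ^ 2) r| ≤
        wint x₀ T (α + 1) (fun x => ‖G x‖ ^ 2) r / 2 +
          3 / 2 * r ^ 2 * wint x₀ T α (fun x => u x ^ 2) r ∧
      (0 < wint x₀ T α (fun x => u x ^ 2) r →
        - (wint x₀ T α (fun x => u x ^ 2) r * (r ^ 2 * wint x₀ T (α + 1) (fun x => ‖G x‖ ^ 2) r +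
          r ^ 4 * wint x₀ T α (fun x => u x ^ 2) r)) ≤
        2 * ((α : ℝ) + 1) * (r * (d' * wint x₀ T α (fun x => u x ^ 2) r -
          wint x₀ T (α + 1) (fun x => ‖G x‖ ^ 2) r * h'))) := by
  obtain ⟨mu, mG, mA, mf⟩ := hs.memLp
  have hQ : ∀ x, ‖G x‖ ^ 2 = ∑ i, G x i ^ 2 := fun x => by
    rw [EuclideanSpace.norm_sq_eq]; simp
  have iu2 : Integrable (fun x => u x ^ 2) (volume.restrict (ball x₀ T)) := mu.integrable_sq
  have iQ : Integrable (fun x => ‖G x‖ ^ 2) (volume.restrict (ball x₀ T)) := by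
    simp only [hQ]; exact integrable_finsetSum _ fun i _ => (mG i).integrable_sq
  have iA2 : Integrable (fun x => rad x₀ G x ^ 2) (volume.restrict (ball x₀ T)) := mA.integrable_sq
  have if2 : Integrable (fun x => f x ^ 2) (volume.restrict (ball x₀ T)) := mf.integrable_sq
  have iuA : Integrable (fun x => u x * rad x₀ G x) (volume.restrict (ball x₀ T)) :=
    mu.integrable_mul mA
  have iuf : Integrable (fun x => u x * f x) (volume.restrict (ball x₀ T)) := mu.integrable_mul mf
  have iAf : Integrable (fun x => rad x₀ G x * f x) (volume.restrict (ball x₀ T)) :=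
    mA.integrable_mul mf
  obtain ⟨h', hh, hh'⟩ := hasDerivAt_wint iu2 hα r
  obtain ⟨d', hd, hd'⟩ := hasDerivAt_wint iQ (show 2 ≤ α + 1 by omega) r
  set h := wint x₀ T α (fun x => u x ^ 2) r
  set d := wint x₀ T (α + 1) (fun x => ‖G x‖ ^ 2) r
  set P := wint x₀ T α (fun x => u x * rad x₀ G x) r with hP
  set S := wint x₀ T α (fun x => rad x₀ G x ^ 2) r with hS
  set E := wint x₀ T (α + 1) (fun x => u x * f x) r with hE
  set F := wint x₀ T (α + 1) (fun x => rad x₀ G x * f x) r with hF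
  set Y := wint x₀ T (α + 2) (fun x => f x ^ 2) r with hY
  have h0 : 0 ≤ h := wint_nonneg (fun x => sq_nonneg _) _ _
  have d0 : 0 ≤ d := wint_nonneg (fun x => sq_nonneg _) _ _
  have id1 : r * h' = (2 * α + n) * h + 2 * P := by
    have e := radial_identity hs hα hr.le hrT
    have e1 : ∫ x in ball x₀ T, wt x₀ r x ^ α * (n * u x ^ 2 + 2 * (u x * rad x₀ G x)) =
        n * h + 2 * P := by
      rw [← wint_const_mul, ← wint_const_mul, ← wint_add (iu2.const_mul _) (iuA.const_mul _)]
      rfl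
    have e2 : ∫ x in ball x₀ T, 2 * α * wt x₀ r x ^ (α - 1) * (‖x - x₀‖ ^ 2 * u x ^ 2) =
        2 * α * ∫ x in ball x₀ T, wt x₀ r x ^ (α - 1) * (‖x - x₀‖ ^ 2 * u x ^ 2) := by
      simp only [← integral_const_mul, mul_assoc]
    rw [hh', ← e2, ← e, e1]; ring
  have id2 : d + E = 2 * (α + 1) * P := by
    have e := energy_identity hs (show 2 ≤ α + 1 by omega) hr.le hrT
    simp only [← hQ] at e
    have e1 : ∫ x in ball x₀ T, wt x₀ r x ^ (α + 1) * (‖G x‖ ^ 2 + u x * f x) = d + E :=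
      wint_add iQ iuf _ _
    have e2 : ∫ x in ball x₀ T, 2 * ((α + 1 : ℕ) : ℝ) * wt x₀ r x ^ (α + 1 - 1) *
        (u x * rad x₀ G x) = 2 * (α + 1) * P := by
      rw [hP, wint, ← integral_const_mul]
      refine integral_congr_ae (ae_of_all _ fun x => ?_)
      push_cast; ring
    rw [← e1, e, e2]
  have id3 : r * d' = (2 * α + n) * d + 4 * (α + 1) * S - 2 * F := by
    have e := pohozaev_identity hs (show 2 ≤ α + 1 by omega) hr.le hrT
    simp only [← hQ] at e
    have e1 : ∫ x in ball x₀ T, wt x₀ r x ^ (α + 1) *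
        ((2 - n) * ‖G x‖ ^ 2 + 2 * (rad x₀ G x * f x)) = (2 - n) * d + 2 * F := by
      rw [← wint_const_mul, ← wint_const_mul, ← wint_add (iQ.const_mul _) (iAf.const_mul _)]
      rfl
    have hi : Integrable (fun x => wt x₀ r x ^ (α + 1 - 1) * (‖x - x₀‖ ^ 2 * ‖G x‖ ^ 2))
        (volume.restrict (ball x₀ T)) := by
      refine integrable_wt_mul ?_ _ _
      obtain ⟨C, hC⟩ := bound_continuous_on_ball (x₀ := x₀) (T := T) (continuous_normsq (x₀ := x₀))
      exact iQ.bdd_mul (continuous_normsq (x₀ := x₀)).aestronglyMeasurable hC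
    have e2 : ∫ x in ball x₀ T, 2 * ((α + 1 : ℕ) : ℝ) * wt x₀ r x ^ (α + 1 - 1) *
        (2 * rad x₀ G x ^ 2 - ‖x - x₀‖ ^ 2 * ‖G x‖ ^ 2) = 4 * (α + 1) * S -
        2 * ((α + 1 : ℕ) : ℝ) *
          ∫ x in ball x₀ T, wt x₀ r x ^ (α + 1 - 1) * (‖x - x₀‖ ^ 2 * ‖G x‖ ^ 2) := by
      rw [hS, wint, ← integral_const_mul, ← integral_const_mul,
        ← integral_sub ((integrable_wt_mul iA2 α r).const_mul _) (hi.const_mul _)]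
      refine integral_congr_ae (ae_of_all _ fun x => ?_)
      push_cast; ring
    rw [e1, e2] at e
    rw [hd']
    push_cast at e ⊢
    linarith
  -- Young's inequality gives `|u f| ≤ |u| |G| + u² ≤ |G|² / 2 + 3 u² / 2`, and one spare power of
  -- the weight is at most `r²`.
  have hEb : |E| ≤ d / 2 + 3 / 2 * r ^ 2 * h := by
    have i1 : Integrable (fun x => (1 / 2) * ‖G x‖ ^ 2 + (3 / 2) * u x ^ 2)
        (volume.restrict (ball x₀ T)) := (iQ.const_mul _).add (iu2.const_mul _)
    have e : wint x₀ T (α + 1) (fun x => (1 / 2) * ‖G x‖ ^ 2 + (3 / 2) * u x ^ 2) r ≤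
        d / 2 + 3 / 2 * r ^ 2 * h := by
      rw [wint_add (iQ.const_mul _) (iu2.const_mul _), wint_const_mul, wint_const_mul]
      have := wint_succ_le iu2 (fun x => sq_nonneg (u x)) α r
      linarith
    have hb : ∀ᵐ x ∂(volume.restrict (ball x₀ T)),
        |u x * f x| ≤ (1 / 2) * ‖G x‖ ^ 2 + (3 / 2) * u x ^ 2 := by
      filter_upwards [hf] with x hx
      rw [abs_mul]
      have := mul_le_mul_of_nonneg_left hx (abs_nonneg (u x))
      nlinarith [sq_nonneg (|u x| - ‖G x‖), sq_abs (u x)]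
    refine abs_le.2 ⟨?_, ?_⟩
    · have := wint_mono (i1.const_mul (-1)) iuf (by
        filter_upwards [hb] with x hx
        linarith [neg_abs_le (u x * f x)]) (α + 1) r
      rw [wint_const_mul] at this
      linarith
    · exact (wint_mono iuf i1 (by
        filter_upwards [hb] with x hx using (le_abs_self _).trans hx) (α + 1) r).trans e
  have hYb : Y ≤ 2 * r ^ 2 * d + 2 * r ^ 4 * h := by
    have i1 : Integrable (fun x => 2 * ‖G x‖ ^ 2 + 2 * u x ^ 2)
        (volume.restrict (ball x₀ T)) := (iQ.const_mul _).add (iu2.const_mul _)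
    have h1 : Y ≤ wint x₀ T (α + 2) (fun x => 2 * ‖G x‖ ^ 2 + 2 * u x ^ 2) r := by
      refine wint_mono if2 i1 ?_ _ _
      filter_upwards [hf] with x hx
      have : f x ^ 2 ≤ (‖G x‖ + |u x|) ^ 2 := by
        rw [← sq_abs (f x)]; exact pow_le_pow_left₀ (abs_nonneg _) hx 2
      nlinarith [sq_nonneg (|u x| - ‖G x‖), sq_abs (u x)]
    rw [wint_add (iQ.const_mul _) (iu2.const_mul _), wint_const_mul, wint_const_mul] at h1
    have h2 := wint_succ_le iQ (fun x => sq_nonneg ‖G x‖) (α + 1) r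
    have h3 := wint_succ_le iu2 (fun x => sq_nonneg (u x)) (α + 1) r
    have h4 := mul_le_mul_of_nonneg_left
      (wint_succ_le iu2 (fun x => sq_nonneg (u x)) α r) (sq_nonneg r)
    have h5 : r ^ 2 * (r ^ 2 * h) = r ^ 4 * h := by ring
    linarith
  have a0 : (0 : ℝ) < α + 1 := by positivity
  -- This is `4(α + 1) ∫ w^α (A - l u - c w f)² ≥ 0` with `A` the radial derivative. The choice `c =
  -- 1 / (4(α + 1))` matches the cross term with `F - l E` and leaves `Y / (4(α + 1))` as the only
  -- error.
  have sq : ∀ l : ℝ, 0 ≤ 4 * (α + 1) * (S - 2 * l * P + l ^ 2 * h) - 2 * (F - l * E) +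
      Y / (4 * (α + 1)) := by
    intro l
    set c : ℝ := 1 / (4 * (α + 1)) with hc
    have hpos : 0 ≤ ∫ x in ball x₀ T,
        wt x₀ r x ^ α * (rad x₀ G x - l * u x - c * (wt x₀ r x * f x)) ^ 2 :=
      integral_nonneg fun x => mul_nonneg (pow_nonneg (wt_nonneg x) _) (sq_nonneg _)
    have e : ∫ x in ball x₀ T,
        wt x₀ r x ^ α * (rad x₀ G x - l * u x - c * (wt x₀ r x * f x)) ^ 2 =
        S + (-2 * l) * P + l ^ 2 * h + ((-2 * c) * F + (2 * l * c) * E) + c ^ 2 * Y := by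
      have j1 : Integrable (fun x => rad x₀ G x ^ 2 + -2 * l * (u x * rad x₀ G x))
        (volume.restrict (ball x₀ T)) := iA2.add (iuA.const_mul _)
      rw [hS, hP, hF, hE, hY, ← wint_const_mul, ← wint_const_mul, ← wint_const_mul,
        ← wint_const_mul, ← wint_const_mul, ← wint_add iA2 (iuA.const_mul _),
        ← wint_add j1 (iu2.const_mul _), ← wint_add (iAf.const_mul _) (iuf.const_mul _)]
      have i1 := integrable_wt_mul (j1.fun_add (iu2.const_mul (l ^ 2))) α r
      have i2 := integrable_wt_mul ((iAf.const_mul (-2 * c)).fun_add (iuf.const_mul (2 * l * c))) (α + 1) r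
      have i3 := integrable_wt_mul (if2.const_mul (c ^ 2)) (α + 2) r
      simp only [wint]
      rw [← integral_add i1 i2, ← integral_add (i1.fun_add i2) i3]
      refine integral_congr_ae (ae_of_all _ fun x => ?_)
      ring
    rw [e] at hpos
    have hca : 4 * (α + 1) * c = 1 := by rw [hc]; field_simp
    have := mul_nonneg (show 0 ≤ 4 * ((α : ℝ) + 1) by positivity) hpos
    have e2 : 4 * ((α : ℝ) + 1) * (S + (-2 * l) * P + l ^ 2 * h + ((-2 * c) * F + (2 * l * c) * E) +
        c ^ 2 * Y) = 4 * (α + 1) * (S - 2 * l * P + l ^ 2 * h) +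
        (4 * (α + 1) * c) * (-2 * (F - l * E)) + (4 * (α + 1) * c) * (c * Y) := by ring
    rw [e2, hca] at this
    have e3 : Y / (4 * (α + 1)) = c * Y := by rw [hc]; ring
    rw [e3]; linarith
  refine ⟨h', d', hh, hd, ?_, ?_⟩
  · rw [show ((α : ℝ) + 1) * (r * h' - (2 * α + n) * h) - d = E by rw [id1]; linear_combination -id2]
    exact hEb
  · intro hpos
    -- The minimiser `l = P / h` turns the quadratic part, multiplied by `h`, into the
    -- Cauchy-Schwarz defect `S h - P²`.
    obtain ⟨l, hl⟩ : ∃ l, l * h = P := ⟨P / h, div_mul_cancel₀ _ hpos.ne'⟩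
    have e1 : h * (4 * (α + 1) * (S - 2 * l * P + l ^ 2 * h) - 2 * (F - l * E) +
        Y / (4 * (α + 1))) = 4 * (α + 1) * (S * h - P ^ 2) - 2 * (F * h - P * E) +
        h * Y / (4 * (α + 1)) := by
      linear_combination (4 * (α + 1) * (l * h - P) + 2 * E) * hl
    have key2 := mul_nonneg h0 (sq l)
    rw [e1] at key2
    have e2 : r * (d' * h - d * h') = 4 * (α + 1) * (S * h - P ^ 2) - 2 * (F * h - P * E) := by
      have : r * (d' * h - d * h') = (r * d') * h - d * (r * h') := by ring
      rw [this, id3, id1]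
      linear_combination (-2 * P) * id2
    rw [e2]
    have e3 : 2 * ((α : ℝ) + 1) * (h * Y / (4 * (α + 1))) = h * Y / 2 := by field_simp; ring
    have k3 := mul_nonneg (show 0 ≤ 2 * ((α : ℝ) + 1) by positivity) key2
    rw [mul_add, e3] at k3
    have k4 := mul_le_mul_of_nonneg_left hYb h0
    linarith

end SchrodingerDoubling

namespace SchrodingerDoubling

/-! ### Consequences of the differential inequalities -/

/-- The differential inequalities satisfied by the weighted height `h` and the weighted Dirichlet
energy `d` of a solution. -/
structure FrequencyPair (h d : ℝ → ℝ) (a p T : ℝ) : Prop where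
  a_pos : 0 < a
  p_nonneg : 0 ≤ p
  sq_le : T ^ 2 ≤ a
  h_nonneg : ∀ r, 0 ≤ h r
  d_nonneg : ∀ r, 0 ≤ d r
  ineq : ∀ r, 0 < r → r ≤ T → ∃ h' d', HasDerivAt h h' r ∧ HasDerivAt d d' r ∧
    |a * (r * h' - p * h r) - d r| ≤ d r / 2 + 3 / 2 * r ^ 2 * h r ∧
    (0 < h r → - (h r * (r ^ 2 * d r + r ^ 4 * h r)) ≤ 2 * a * (r * (d' * h r - d r * h')))

namespace FrequencyPair

variable {h d : ℝ → ℝ} {a p T : ℝ}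

/-- The last differential inequality reads `N' ≥ -(r N + r³) / (2a)` for `N = d / h`, so `exp(r² /
(4a)) (N + r²)` is nondecreasing. Since `T² ≤ a`, the exponential lies between 1 and `exp(1/4) ≤ 2`.
-/
lemma frequency_le (F : FrequencyPair h d a p T) {s t : ℝ} (hs : 0 < s) (hst : s ≤ t) (htT : t ≤ T)
    (hpos : ∀ r ∈ Icc s t, 0 < h r) : d s / h s ≤ 2 * (d t / h t + t ^ 2) := by
  have ha := F.a_pos
  choose! h' d' h1 h2 h3 h4 using F.ineq
  have hin : ∀ r ∈ Icc s t, 0 < r ∧ r ≤ T := fun r hr => ⟨hs.trans_le hr.1, hr.2.trans htT⟩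
  have hder : ∀ r ∈ Icc s t, HasDerivAt (fun r => Real.exp (r ^ 2 / (4 * a)) * (d r / h r + r ^ 2))
      (Real.exp (r ^ 2 / (4 * a)) * (2 * r / (4 * a)) * (d r / h r + r ^ 2) +
        Real.exp (r ^ 2 / (4 * a)) * ((d' r * h r - d r * h' r) / h r ^ 2 + 2 * r)) r := by
    intro r hr
    obtain ⟨r0, rT⟩ := hin r hr
    have e1 : HasDerivAt (fun r : ℝ => r ^ 2) (2 * r) r := by simpa using hasDerivAt_pow 2 r
    exact (e1.div_const (4 * a)).exp.mul (((h2 r r0 rT).div (h1 r r0 rT) (hpos r hr).ne').add e1)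
  have hmono : MonotoneOn (fun r => Real.exp (r ^ 2 / (4 * a)) * (d r / h r + r ^ 2)) (Icc s t) := by
    refine monotoneOn_of_hasDerivWithinAt_nonneg (convex_Icc s t)
      (fun r hr => (hder r hr).continuousAt.continuousWithinAt)
      (fun r hr => (hder r (interior_subset hr)).hasDerivWithinAt) fun r hr => ?_
    have hr' := interior_subset hr
    obtain ⟨r0, rT⟩ := hin r hr'
    have hp := hpos r hr'
    have key := h4 r r0 rT hp
    have e : - ((r * (d r / h r) + r ^ 3) / (2 * a)) ≤ (d' r * h r - d r * h' r) / h r ^ 2 := by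
      rw [← neg_div, div_le_div_iff₀ (by positivity) (by positivity)]
      have e1 : -(r * (d r / h r) + r ^ 3) * h r ^ 2 = -(h r * (r * d r + r ^ 3 * h r)) := by
        field_simp
      rw [e1]
      refine le_of_mul_le_mul_left ?_ r0
      linarith
    rw [mul_assoc, ← mul_add]
    refine mul_nonneg (Real.exp_pos _).le ?_
    have e2 : 2 * r / (4 * a) * (d r / h r + r ^ 2) = (r * (d r / h r) + r ^ 3) / (2 * a) := by
      field_simp; ring
    rw [e2]; linarith
  have hle := hmono (left_mem_Icc.2 hst) (right_mem_Icc.2 hst) hst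
  simp only at hle
  have hMs : 0 ≤ d s / h s := div_nonneg (F.d_nonneg s) (F.h_nonneg s)
  have hMt : 0 ≤ d t / h t := div_nonneg (F.d_nonneg t) (F.h_nonneg t)
  have hes : 1 ≤ Real.exp (s ^ 2 / (4 * a)) := Real.one_le_exp (by positivity)
  have het : Real.exp (t ^ 2 / (4 * a)) ≤ 2 := by
    have h1 : t ^ 2 / (4 * a) ≤ 1 / 4 := by
      rw [div_le_div_iff₀ (by positivity) (by norm_num)]
      have := pow_le_pow_left₀ (hs.le.trans hst) htT 2
      linarith [F.sq_le]
    have h2 : Real.exp (1 / 4) ≤ 2 := by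
      have h3 : Real.exp (1 / 4) ≤ Real.exp (Real.log 2) := by
        rw [Real.exp_le_exp]; linarith [Real.log_two_gt_d9]
      rwa [Real.exp_log (by norm_num)] at h3
    exact (Real.exp_le_exp.2 h1).trans h2
  calc d s / h s ≤ d s / h s + s ^ 2 := by linarith [sq_nonneg s]
    _ ≤ Real.exp (s ^ 2 / (4 * a)) * (d s / h s + s ^ 2) :=
        le_mul_of_one_le_left (by positivity) hes
    _ ≤ _ := hle
    _ ≤ _ := mul_le_mul_of_nonneg_right het (by positivity)

/-- The upper half of the bound on `r h'` gives `r h' / h ≤ q`, so `q log r - log h` is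
nondecreasing. -/
lemma log_growth_le (F : FrequencyPair h d a p T) {s t q : ℝ} (hs : 0 < s) (hst : s ≤ t)
    (htT : t ≤ T) (hpos : ∀ r ∈ Icc s t, 0 < h r)
    (hq : ∀ r ∈ Icc s t, a * p + 3 / 2 * (d r / h r) + 3 / 2 * r ^ 2 ≤ a * q) :
    Real.log (h t) - Real.log (h s) ≤ q * (Real.log t - Real.log s) := by
  have ha := F.a_pos
  choose! h' d' h1 h2 h3 h4 using F.ineq
  have hin : ∀ r ∈ Icc s t, 0 < r ∧ r ≤ T := fun r hr => ⟨hs.trans_le hr.1, hr.2.trans htT⟩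
  have hder : ∀ r ∈ Icc s t, HasDerivAt (fun r => q * Real.log r - Real.log (h r))
      (q * r⁻¹ - h' r / h r) r := by
    intro r hr
    obtain ⟨r0, rT⟩ := hin r hr
    exact ((Real.hasDerivAt_log r0.ne').const_mul q).sub ((h1 r r0 rT).log (hpos r hr).ne')
  have hmono : MonotoneOn (fun r => q * Real.log r - Real.log (h r)) (Icc s t) := by
    refine monotoneOn_of_hasDerivWithinAt_nonneg (convex_Icc s t)
      (fun r hr => (hder r hr).continuousAt.continuousWithinAt)
      (fun r hr => (hder r (interior_subset hr)).hasDerivWithinAt) fun r hr => ?_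
    have hr' := interior_subset hr
    obtain ⟨r0, rT⟩ := hin r hr'
    have hp := hpos r hr'
    have key := (abs_le.1 (h3 r r0 rT)).2
    have e := mul_le_mul_of_nonneg_right (hq r hr') hp.le
    have e1 : (a * p + 3 / 2 * (d r / h r) + 3 / 2 * r ^ 2) * h r =
      a * p * h r + 3 / 2 * d r + 3 / 2 * r ^ 2 * h r := by field_simp
    rw [e1] at e
    rw [sub_nonneg, ← div_eq_mul_inv, div_le_div_iff₀ hp r0]
    refine le_of_mul_le_mul_left ?_ ha
    linarith
  have := hmono (left_mem_Icc.2 hst) (right_mem_Icc.2 hst) hst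
  simp only at this
  linarith

/-- The counterpart from the lower half of the bound on `r h'`. It lets observed growth of `h` bound
the frequency. -/
lemma le_log_growth (F : FrequencyPair h d a p T) {s t q : ℝ} (hs : 0 < s) (hst : s ≤ t)
    (htT : t ≤ T) (hpos : ∀ r ∈ Icc s t, 0 < h r)
    (hq : ∀ r ∈ Icc s t, a * q ≤ a * p + 1 / 2 * (d r / h r) - 3 / 2 * r ^ 2) :
    q * (Real.log t - Real.log s) ≤ Real.log (h t) - Real.log (h s) := by
  have ha := F.a_pos
  choose! h' d' h1 h2 h3 h4 using F.ineq
  have hin : ∀ r ∈ Icc s t, 0 < r ∧ r ≤ T := fun r hr => ⟨hs.trans_le hr.1, hr.2.trans htT⟩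
  have hder : ∀ r ∈ Icc s t, HasDerivAt (fun r => Real.log (h r) - q * Real.log r)
      (h' r / h r - q * r⁻¹) r := by
    intro r hr
    obtain ⟨r0, rT⟩ := hin r hr
    exact ((h1 r r0 rT).log (hpos r hr).ne').sub ((Real.hasDerivAt_log r0.ne').const_mul q)
  have hmono : MonotoneOn (fun r => Real.log (h r) - q * Real.log r) (Icc s t) := by
    refine monotoneOn_of_hasDerivWithinAt_nonneg (convex_Icc s t)
      (fun r hr => (hder r hr).continuousAt.continuousWithinAt)
      (fun r hr => (hder r (interior_subset hr)).hasDerivWithinAt) fun r hr => ?_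
    have hr' := interior_subset hr
    obtain ⟨r0, rT⟩ := hin r hr'
    have hp := hpos r hr'
    have key := (abs_le.1 (h3 r r0 rT)).1
    have e := mul_le_mul_of_nonneg_right (hq r hr') hp.le
    have e1 : (a * p + 1 / 2 * (d r / h r) - 3 / 2 * r ^ 2) * h r =
      a * p * h r + 1 / 2 * d r - 3 / 2 * r ^ 2 * h r := by field_simp
    rw [e1] at e
    rw [sub_nonneg, ← div_eq_mul_inv, div_le_div_iff₀ r0 hp]
    refine le_of_mul_le_mul_left ?_ ha
    linarith
  have := hmono (left_mem_Icc.2 hst) (right_mem_Icc.2 hst) hst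
  simp only at this
  linarith

/-- Frequency monotonicity replaces `N(r)` by its value at the outer radius `t`. The terms in `r²`
and `t²` are at most `a` and add up to `9/2` after division by `a`. -/
lemma log_growth_le_frequency (F : FrequencyPair h d a p T) {s s' t : ℝ} (hs : 0 < s)
    (hss : s ≤ s') (hst : s' ≤ t) (htT : t ≤ T) (hpos : ∀ r ∈ Icc s t, 0 < h r) :
    Real.log (h s') - Real.log (h s) ≤
      (p + 3 * (d t / h t) / a + 9 / 2) * (Real.log s' - Real.log s) := by
  have ha := F.a_pos
  have hT2 : t ^ 2 ≤ a := (pow_le_pow_left₀ (hs.le.trans (hss.trans hst)) htT 2).trans F.sq_le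
  refine F.log_growth_le hs hss (hst.trans htT) (fun r hr => hpos r ⟨hr.1, hr.2.trans hst⟩)
    fun r hr => ?_
  have h1 := F.frequency_le (hs.trans_le hr.1) (hr.2.trans hst) htT
    fun q hq => hpos q ⟨hr.1.trans hq.1, hq.2⟩
  have h2 : r ^ 2 ≤ a :=
    (pow_le_pow_left₀ (hs.le.trans hr.1) (hr.2.trans hst) 2).trans hT2
  have e : a * (p + 3 * (d t / h t) / a + 9 / 2) = a * p + 3 * (d t / h t) + 9 / 2 * a := by
    field_simp
  rw [e]; linarith

/-- A form of unique continuation. Just to the right of the last zero before `t`, the growth rate is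
bounded by the frequency at `t`, so `h` stays above a positive constant there, contradicting
continuity. -/
lemma pos_of_pos (F : FrequencyPair h d a p T) {s t : ℝ} (hs : 0 < s) (hst : s ≤ t) (htT : t ≤ T)
    (ht : 0 < h t) : 0 < h s := by
  by_contra hn
  have hs0 : h s = 0 := le_antisymm (not_lt.1 hn) (F.h_nonneg s)
  have hcont : ContinuousOn h (Icc s t) := fun r hr => by
    obtain ⟨h', d', h1, -⟩ := F.ineq r (hs.trans_le hr.1) (hr.2.trans htT)
    exact h1.continuousAt.continuousWithinAt
  set Z := Icc s t ∩ h ⁻¹' {0} with hZ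
  have hZc : IsClosed Z := hcont.preimage_isClosed_of_isClosed isClosed_Icc isClosed_singleton
  have hZn : Z.Nonempty := ⟨s, left_mem_Icc.2 hst, hs0⟩
  have hZb : BddAbove Z := ⟨t, fun r hr => hr.1.2⟩
  have hmem := hZc.csSup_mem hZn hZb
  set z := sSup Z with hz
  have hz0 : h z = 0 := hmem.2
  have hzs : 0 < z := hs.trans_le hmem.1.1
  have hzt : z < t := lt_of_le_of_ne hmem.1.2 fun e => by rw [e] at hz0; exact ht.ne' hz0
  have hpos : ∀ r, z < r → r ≤ t → 0 < h r := fun r h1 h2 =>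
    lt_of_le_of_ne (F.h_nonneg r) fun e =>
      absurd (le_csSup hZb (⟨⟨hmem.1.1.trans h1.le, h2⟩, e.symm⟩ : r ∈ Z)) (not_le.2 h1)
  have ha := F.a_pos
  set q := p + 3 * (d t / h t) / a + 9 / 2
  have hq : 0 ≤ q := by
    have := F.p_nonneg
    have := F.d_nonneg t
    positivity
  have hlow : ∀ r ∈ Ioc z t, h t * Real.exp (-(q * (Real.log t - Real.log z))) ≤ h r := by
    intro r hr
    have h1 := F.log_growth_le_frequency (hzs.trans hr.1) hr.2 le_rfl htT
      fun x hx => hpos x (hr.1.trans_le hx.1) hx.2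
    have h2 : q * (Real.log t - Real.log r) ≤ q * (Real.log t - Real.log z) :=
      mul_le_mul_of_nonneg_left (by linarith [Real.log_le_log hzs hr.1.le]) hq
    rw [← Real.exp_log (hpos r hr.1 hr.2)]
    nth_rw 1 [← Real.exp_log ht]
    rw [← Real.exp_add, Real.exp_le_exp]
    have h3 := h1.trans h2
    linarith
  have hlim : Tendsto h (𝓝[>] z) (𝓝 (h z)) := by
    obtain ⟨h', d', h1, -⟩ := F.ineq z hzs (hzt.le.trans htT)
    exact h1.continuousAt.tendsto.mono_left nhdsWithin_le_nhds
  have := ge_of_tendsto hlim (by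
    filter_upwards [Ioc_mem_nhdsGT hzt] with r hr using hlow r hr)
  rw [hz0] at this
  have : 0 < h t * Real.exp (-(q * (Real.log t - Real.log z))) := by positivity
  linarith

/-- Growth at small scales is controlled by the growth at the largest scale. -/
theorem doubling (F : FrequencyPair h d a p T) {s s' t : ℝ} (hs : 0 < s) (hss : s ≤ s')
    (hst : s' ≤ t) (htT : t < T) (hmono : ∀ r ∈ Icc t T, 0 < h r) :
    0 < h s ∧ Real.log (h s') - Real.log (h s) ≤
      (12 * ((Real.log (h T) - Real.log (h t)) / (Real.log T - Real.log t)) + 29) *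
        (Real.log s' - Real.log s) := by
  have ha := F.a_pos
  have ht0 : 0 < t := hs.trans_le (hss.trans hst)
  have ht : 0 < h t := hmono t ⟨le_rfl, htT.le⟩
  have hp := F.p_nonneg
  have hpos : ∀ r ∈ Icc s t, 0 < h r := fun r hr => F.pos_of_pos (hs.trans_le hr.1) hr.2 htT.le ht
  refine ⟨hpos s ⟨le_rfl, hss.trans hst⟩, ?_⟩
  refine (F.log_growth_le_frequency hs hss hst htT.le hpos).trans ?_
  refine mul_le_mul_of_nonneg_right ?_ (by linarith [Real.log_le_log hs hss])
  have hlog : 0 < Real.log T - Real.log t := by linarith [Real.log_lt_log ht0 htT]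
  -- For `r ≥ t`, monotonicity gives `N(r) ≥ N(t) / 2 - r²`. Hence the logarithmic slope of `h` on
  -- `[t, T]` is at least `p + N(t) / (4a) - 2`, which bounds `N(t)` by the observed growth. The net
  -- contribution of `p` is negative and is dropped.
  have hlow := F.le_log_growth (q := p + (d t / h t) / (4 * a) - 2) ht0 htT.le le_rfl hmono
    fun r hr => by
      have h1 := F.frequency_le ht0 hr.1 hr.2 fun x hx => hmono x ⟨hx.1, hx.2.trans hr.2⟩
      have h2 : r ^ 2 ≤ a := (pow_le_pow_left₀ (ht0.le.trans hr.1) hr.2 2).trans F.sq_le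
      have e : a * (p + (d t / h t) / (4 * a) - 2) = a * p + (d t / h t) / 4 - 2 * a := by
        field_simp
      rw [e]; linarith
  rw [← le_div_iff₀ hlog] at hlow
  have e : 3 * (d t / h t) / a = 12 * ((d t / h t) / (4 * a)) := by field_simp; ring
  rw [e]; linarith

end FrequencyPair

end SchrodingerDoubling

/-! ### From the weighted height to the mass on balls. -/

namespace SchrodingerDoubling

variable {n : ℕ} {x₀ : 𝔼 n} {T r : ℝ} {u f : (𝔼 n) → ℝ} {G : (𝔼 n) → (𝔼 n)}

lemma frequencyPair (hs : IsSmoothLimit x₀ T u G f)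
    (hf : ∀ᵐ x ∂(volume.restrict (ball x₀ T)), |f x| ≤ ‖G x‖ + |u x|)
    {α : ℕ} (hα : 2 ≤ α) (hT : T ^ 2 ≤ α + 1) :
    FrequencyPair (wint x₀ T α fun x => u x ^ 2) (wint x₀ T (α + 1) fun x => ‖G x‖ ^ 2)
      (α + 1) (2 * α + n) T :=
  ⟨by positivity, by positivity, hT, wint_nonneg (fun x => sq_nonneg _) _,
    wint_nonneg (fun x => sq_nonneg _) _, fun _ hr hrT => frequency_inequalities hs hf hα hr hrT⟩

lemma H_nonneg (u : (𝔼 n) → ℝ) (x : 𝔼 n) (r : ℝ) : 0 ≤ H u x r :=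
  integral_nonneg fun _ => sq_nonneg _

lemma H_mono {x y : 𝔼 n} {r s : ℝ} (h : ball x r ⊆ ball y s) (hu : IntegrableOn (fun z => u z ^ 2) (ball y s)) :
    H u x r ≤ H u y s :=
  setIntegral_mono_set hu (ae_of_all _ fun _ => sq_nonneg _) (ae_of_all _ h)

lemma wint_le_H (hu : IntegrableOn (fun z => u z ^ 2) (ball x₀ T)) (hr : 0 ≤ r) (hrT : r ≤ T)
    {k : ℕ} (hk : k ≠ 0) : wint x₀ T k (fun x => u x ^ 2) r ≤ (r ^ 2) ^ k * H u x₀ r := by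
  have hz : ∀ x ∈ ball x₀ T \ ball x₀ r, wt x₀ r x ^ k * u x ^ 2 = 0 := fun x hx => by
    rw [wt_eq_zero hr hx.2, zero_pow hk, zero_mul]
  rw [wint, setIntegral_eq_of_subset_of_forall_sdiff_eq_zero measurableSet_ball
    (ball_subset_ball hrT) hz, H, ← integral_const_mul]
  refine integral_mono ((integrable_wt_mul hu k r).mono_measure
    (Measure.restrict_mono (ball_subset_ball hrT) le_rfl))
    ((hu.mono_set (ball_subset_ball hrT)).const_mul _) fun x => ?_
  exact mul_le_mul_of_nonneg_right (pow_le_pow_left₀ (wt_nonneg x) (wt_le x) k) (sq_nonneg _)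

lemma le_wt_of_mem {s : ℝ} {x : 𝔼 n} (hx : x ∈ ball x₀ s) : r ^ 2 - s ^ 2 ≤ wt x₀ r x := by
  refine le_trans ?_ (le_max_right _ _)
  have := mem_ball_iff_norm.1 hx
  have := pow_le_pow_left₀ (norm_nonneg _) this.le 2
  linarith

/-- On the smaller ball the weight is at least `r² - s²`. Together with `wint_le_H` this exchanges
`h` and `H` at the price of enlarging the radius. -/
lemma H_le_wint (hu : IntegrableOn (fun z => u z ^ 2) (ball x₀ T)) {s : ℝ} (hs : 0 ≤ s)
    (hsr : s ≤ r) (hrT : r ≤ T) (k : ℕ) :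
    (r ^ 2 - s ^ 2) ^ k * H u x₀ s ≤ wint x₀ T k (fun x => u x ^ 2) r := by
  have hsub : ball x₀ s ⊆ ball x₀ T := ball_subset_ball (hsr.trans hrT)
  have h1 : ∫ x in ball x₀ s, wt x₀ r x ^ k * u x ^ 2 ≤ wint x₀ T k (fun x => u x ^ 2) r :=
    setIntegral_mono_set (integrable_wt_mul hu k r)
      (ae_of_all _ fun x => mul_nonneg (pow_nonneg (wt_nonneg x) _) (sq_nonneg _))
      (ae_of_all _ hsub)
  refine le_trans ?_ h1
  rw [H, ← integral_const_mul]
  refine setIntegral_mono_on ((hu.mono_set hsub).const_mul _)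
    ((integrable_wt_mul hu k r).mono_measure (Measure.restrict_mono hsub le_rfl))
    measurableSet_ball fun x hx => ?_
  exact mul_le_mul_of_nonneg_right
    (pow_le_pow_left₀ (by nlinarith) (le_wt_of_mem hx) k) (sq_nonneg _)

/-- A doubling inequality at all small scales from one at the largest scale. -/
theorem doubling_of_growth (hs : IsSmoothLimit x₀ T u G f)
    (hf : ∀ᵐ x ∂(volume.restrict (ball x₀ T)), |f x| ≤ ‖G x‖ + |u x|) (hT : 0 < T)
    {R : ℝ} (hTR : T ≤ R) {l : ℝ} (hpos : 0 < H u x₀ (2 * T / 3))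
    (hl : H u x₀ T ≤ Real.exp l * H u x₀ (2 * T / 3)) {s : ℝ} (hs0 : 0 < s) (hsT : s ≤ T / 3) :
    0 < H u x₀ s ∧ H u x₀ (2 * s) ≤ Real.exp (461 * (1 + R ^ 2) + 72 * l) * H u x₀ s := by
  have hu : IntegrableOn (fun z => u z ^ 2) (ball x₀ T) := hs.memLp.1.integrable_sq
  -- Large enough for `T² ≤ α + 1` and `2 ≤ α`, yet at most `R² + 3`, so that losses linear in `α`
  -- are affordable.
  set α : ℕ := ⌈R ^ 2⌉₊ + 2 with hαd
  have hα : 2 ≤ α := by omega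
  have hα1 : R ^ 2 ≤ α := by
    rw [hαd]; push_cast; linarith [Nat.le_ceil (R ^ 2)]
  have hα2 : (α : ℝ) ≤ R ^ 2 + 3 := by
    rw [hαd]; push_cast; linarith [Nat.ceil_lt_add_one (sq_nonneg R)]
  have hT2 : T ^ 2 ≤ (α : ℝ) + 1 := by
    have := pow_le_pow_left₀ hT.le hTR 2
    linarith
  have F := frequencyPair hs hf hα hT2
  set h := wint x₀ T α fun x => u x ^ 2 with hh
  have low : ∀ ρ ∈ Icc (5 * T / 6) T, 0 < h ρ := by
    intro ρ hρ
    refine lt_of_lt_of_le ?_ (H_le_wint hu (by positivity : 0 ≤ 2 * T / 3)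
      (by linarith [hρ.1]) hρ.2 α)
    refine mul_pos (pow_pos ?_ _) hpos
    nlinarith [hρ.1]
  -- The radius `5s/2` exceeds `2s`, so on the ball of radius `2s` its weight is at least `s²`. The
  -- matching factors `(s²)^α` then cancel between the bounds for `h (5s/2)` and `h s`.
  obtain ⟨hsp, hd⟩ := F.doubling hs0 (show s ≤ 5 * s / 2 by linarith)
    (show 5 * s / 2 ≤ 5 * T / 6 by linarith) (show 5 * T / 6 < T by linarith) low
  have up : h s ≤ (s ^ 2) ^ α * H u x₀ s := wint_le_H hu hs0.le (by linarith) (by omega)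
  have Hs : 0 < H u x₀ s := by
    by_contra hn
    have : H u x₀ s = 0 := le_antisymm (not_lt.1 hn) (H_nonneg _ _ _)
    rw [this, mul_zero] at up
    linarith
  refine ⟨Hs, ?_⟩
  have hTp := low T ⟨by linarith, le_rfl⟩
  have htp := low (5 * T / 6) ⟨le_rfl, by linarith⟩
  have upT : Real.log (h T) ≤ α * Real.log (T ^ 2) + l + Real.log (H u x₀ (2 * T / 3)) := by
    have h1 : h T ≤ (T ^ 2) ^ α * (Real.exp l * H u x₀ (2 * T / 3)) :=
      (wint_le_H hu hT.le le_rfl (by omega)).trans (mul_le_mul_of_nonneg_left hl (by positivity))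
    have h2 := Real.log_le_log hTp h1
    rwa [Real.log_mul (by positivity) (by positivity), Real.log_mul (by positivity) hpos.ne',
      Real.log_exp, Real.log_pow, ← add_assoc] at h2
  have lowt : α * (Real.log (T ^ 2) - Real.log 4) + Real.log (H u x₀ (2 * T / 3)) ≤
      Real.log (h (5 * T / 6)) := by
    have h1 := H_le_wint hu (by positivity : 0 ≤ 2 * T / 3)
      (show 2 * T / 3 ≤ 5 * T / 6 by linarith) (by linarith) α
    rw [show (5 * T / 6) ^ 2 - (2 * T / 3) ^ 2 = T ^ 2 / 4 by ring] at h1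
    have h2 := Real.log_le_log (by positivity) h1
    rwa [Real.log_mul (by positivity) hpos.ne', Real.log_pow,
      Real.log_div (by positivity) (by norm_num)] at h2
  have ups : Real.log (h s) ≤ α * Real.log (s ^ 2) + Real.log (H u x₀ s) := by
    have h2 := Real.log_le_log hsp up
    rwa [Real.log_mul (by positivity) Hs.ne', Real.log_pow] at h2
  have H2s : 0 < H u x₀ (2 * s) := lt_of_lt_of_le Hs
    (H_mono (ball_subset_ball (by linarith)) (hu.mono_set (ball_subset_ball (by linarith))))
  have lows : α * Real.log (s ^ 2) + Real.log (H u x₀ (2 * s)) ≤ Real.log (h (5 * s / 2)) := by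
    have h1 := H_le_wint hu (by positivity : 0 ≤ 2 * s)
      (show 2 * s ≤ 5 * s / 2 by linarith) (by linarith) α
    have h3 : (s ^ 2) ^ α * H u x₀ (2 * s) ≤ h (5 * s / 2) :=
      (mul_le_mul_of_nonneg_right (pow_le_pow_left₀ (by positivity) (by nlinarith) α) H2s.le).trans h1
    have h2 := Real.log_le_log (by positivity) h3
    rwa [Real.log_mul (by positivity) H2s.ne', Real.log_pow] at h2
  have l4 : Real.log 4 ≤ 2 := by
    rw [show (4 : ℝ) = 2 ^ 2 by norm_num, Real.log_pow]
    push_cast; linarith [Real.log_two_lt_d9]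
  have hα0 : (0 : ℝ) ≤ α := Nat.cast_nonneg α
  have hαl := mul_le_mul_of_nonneg_left l4 hα0
  have num : Real.log (h T) - Real.log (h (5 * T / 6)) ≤ 2 * α + l := by linarith
  have hlT : (1 : ℝ) / 6 ≤ Real.log T - Real.log (5 * T / 6) := by
    rw [← Real.log_div hT.ne' (by positivity), show T / (5 * T / 6) = 6 / 5 by field_simp]
    have := Real.one_sub_inv_le_log_of_pos (show (0 : ℝ) < 6 / 5 by norm_num)
    norm_num at this ⊢; linarith
  -- Forced by monotonicity of `H` in the radius.
  have hl0 : 0 ≤ l := by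
    by_contra hn
    have h1 : Real.exp l < 1 := by rw [Real.exp_lt_one_iff]; linarith
    have h2 : H u x₀ (2 * T / 3) ≤ H u x₀ T := H_mono (ball_subset_ball (by linarith)) hu
    nlinarith
  have quo : (Real.log (h T) - Real.log (h (5 * T / 6))) / (Real.log T - Real.log (5 * T / 6)) ≤
      6 * (2 * α + l) := by
    rw [div_le_iff₀ (by linarith)]
    have := mul_le_mul_of_nonneg_left hlT (show 0 ≤ 2 * α + l by positivity)
    linarith
  have hls : Real.log (5 * s / 2) - Real.log s ≤ 1 := by
    rw [← Real.log_div (by positivity) hs0.ne', show 5 * s / 2 / s = 5 / 2 by field_simp,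
      Real.log_le_iff_le_exp (by norm_num)]
    linarith [Real.exp_one_gt_d9]
  have hls0 : 0 ≤ Real.log (5 * s / 2) - Real.log s := by
    linarith [Real.log_le_log hs0 (show s ≤ 5 * s / 2 by linarith)]
  -- The factor 72 is `12 · 6`, with 6 from `log (6/5) ≥ 1/6`. Using `α ≤ R² + 3`, the final
  -- constant is `461 = 144 · 3 + 29`.
  have tot : Real.log (h (5 * s / 2)) - Real.log (h s) ≤ 72 * (2 * α + l) + 29 := by
    refine hd.trans ?_
    refine (mul_le_mul_of_nonneg_right (show _ ≤ 72 * (2 * α + l) + 29 by linarith) hls0).trans ?_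
    exact mul_le_of_le_one_right (by positivity) hls
  rw [← Real.log_le_log_iff H2s (by positivity), Real.log_mul (Real.exp_ne_zero _) Hs.ne',
    Real.log_exp]
  linarith [sq_nonneg R]

/-- A solution with bounded coefficients grows at least by a fixed factor on small balls. -/
theorem growth_lower_bound (hn : 2 ≤ n) {R : ℝ} (hR : 0 < R)
    (hs : IsSmoothLimit x₀ (9 * R / 10) u G f)
    (hf : ∀ᵐ x ∂(volume.restrict (ball x₀ (9 * R / 10))), |f x| ≤ ‖G x‖ + |u x|) :
    83 / 10 * H u x₀ (R / 2) ≤ (81 / 10 + R ^ 2) * H u x₀ (9 * R / 10) := by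
  set T := 9 * R / 10 with hT
  have hT0 : 0 < T := by positivity
  have hu : IntegrableOn (fun z => u z ^ 2) (ball x₀ T) := hs.memLp.1.integrable_sq
  -- With exponent 2 and `d ≥ 0`, this gives `T h' - (4 + n) h ≥ -T² h / 2`.
  obtain ⟨h', d', h1, -, h3, -⟩ := frequency_inequalities hs hf le_rfl hT0 le_rfl
  have h2 := h1.unique (hasDerivAt_integral_wt hu le_rfl T)
  have hd0 : 0 ≤ wint x₀ T (2 + 1) (fun x => ‖G x‖ ^ 2) T := wint_nonneg (fun x => sq_nonneg _) _ _
  have hh := wint_le_H hu hT0.le le_rfl two_ne_zero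
  have key := (abs_le.1 h3).1
  generalize wint x₀ T (2 + 1) (fun x => ‖G x‖ ^ 2) T = D at hd0 key
  set h := wint x₀ T 2 (fun x => u x ^ 2) T with hhd
  have hsub : ball x₀ (R / 2) ⊆ ball x₀ T := ball_subset_ball (by linarith)
  have e : T * h' - (2 * (2 : ℕ) + n) * h =
      ∫ x in ball x₀ T, (4 * T ^ 2 * wt x₀ T x - (4 + n) * wt x₀ T x ^ 2) * u x ^ 2 := by
    rw [h2, hhd, wint, ← integral_const_mul, ← integral_const_mul,
      ← integral_sub ((((integrable_wt_mul hu (2 - 1) T)).const_mul _).const_mul _)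
        ((integrable_wt_mul hu 2 T).const_mul _)]
    refine integral_congr_ae (ae_of_all _ fun x => ?_)
    push_cast; ring
  have hn' : (2 : ℝ) ≤ n := by exact_mod_cast hn
  -- The integrand is negative on the half ball: there `w ≥ (81/100 - 25/100) R²`, and `n ≥ 2` gives
  -- `(4 + n) w ≥ 6 w > 4 T²`, with the margin `12/100 · 56/100 = 672/10000`. Elsewhere it is at
  -- most `4 T⁴ u² ≤ 27/10 R⁴ u²`.
  have hb : ∫ x in ball x₀ T, (4 * T ^ 2 * wt x₀ T x - (4 + n) * wt x₀ T x ^ 2) * u x ^ 2 ≤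
      ∫ x in ball x₀ T, (27 / 10 * R ^ 4 * u x ^ 2 -
        (ball x₀ (R / 2)).indicator (fun x => (27 / 10 + 672 / 10000) * R ^ 4 * u x ^ 2) x) := by
    have i1 : Integrable (fun x => (4 * T ^ 2 * wt x₀ T x - (4 + n) * wt x₀ T x ^ 2) * u x ^ 2)
        (volume.restrict (ball x₀ T)) := by
      have := ((integrable_wt_mul hu 1 T).const_mul (4 * T ^ 2)).sub
        ((integrable_wt_mul hu 2 T).const_mul (4 + n))
      refine this.congr (ae_of_all _ fun x => ?_)
      simp only [Pi.sub_apply]; ring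
    refine integral_mono i1 ((hu.const_mul _).sub ((hu.const_mul _).indicator measurableSet_ball))
      fun x => ?_
    have w0 := wt_nonneg (x₀ := x₀) (r := T) x
    have w1 := wt_le (x₀ := x₀) (r := T) x
    have hT2 : T ^ 2 = 81 / 100 * R ^ 2 := by rw [hT]; ring
    by_cases hx : x ∈ ball x₀ (R / 2)
    · simp only [hx, indicator_of_mem, ← sub_mul]
      refine mul_le_mul_of_nonneg_right ?_ (sq_nonneg _)
      have w2 := le_wt_of_mem (r := T) hx
      have w3 : 56 / 100 * R ^ 2 ≤ wt x₀ T x := by linarith [sq_nonneg R]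
      have c1 : 4 * T ^ 2 - (4 + n) * wt x₀ T x ≤ - (12 / 100) * R ^ 2 := by
        have : 6 * wt x₀ T x ≤ (4 + n) * wt x₀ T x := by
          refine mul_le_mul_of_nonneg_right (by linarith) w0
        linarith
      have c2 := mul_le_mul_of_nonneg_left c1 w0
      have c3 := mul_le_mul_of_nonneg_left w3 (show 0 ≤ 12 / 100 * R ^ 2 by positivity)
      linarith
    · simp only [hx, not_false_eq_true, indicator_of_notMem, sub_zero]
      refine mul_le_mul_of_nonneg_right ?_ (sq_nonneg _)
      have c1 : 0 ≤ (4 + n) * wt x₀ T x ^ 2 := by positivity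
      have c2 := mul_le_mul_of_nonneg_left w1 (show 0 ≤ 4 * T ^ 2 by positivity)
      rw [hT2] at c2 ⊢
      linarith [pow_pos hR 4]
  have hr : ∫ x in ball x₀ T, (27 / 10 * R ^ 4 * u x ^ 2 -
        (ball x₀ (R / 2)).indicator (fun x => (27 / 10 + 672 / 10000) * R ^ 4 * u x ^ 2) x) =
      27 / 10 * R ^ 4 * H u x₀ T - (27 / 10 + 672 / 10000) * R ^ 4 * H u x₀ (R / 2) := by
    rw [integral_sub (hu.const_mul _) ((hu.const_mul _).indicator measurableSet_ball),
      setIntegral_indicator measurableSet_ball, inter_eq_self_of_subset_right hsub,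
      integral_const_mul, integral_const_mul, H, H]
  rw [hr, ← e] at hb
  have hT2 : T ^ 2 = 81 / 100 * R ^ 2 := by rw [hT]; ring
  have hh' : h ≤ 66 / 100 * R ^ 4 * H u x₀ T := by
    refine hh.trans (mul_le_mul_of_nonneg_right ?_ (H_nonneg _ _ _))
    rw [hT2]; linarith [pow_pos hR 4]
  have hT0' := H_nonneg u x₀ T
  have f1 := mul_le_mul_of_nonneg_left hh' (show 0 ≤ 3 / 2 * T ^ 2 by positivity)
  rw [hT2] at f1 key
  have f2 : 0 ≤ R ^ 6 * H u x₀ T := by positivity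
  have f3 : 0 ≤ R ^ 4 * H u x₀ (R / 2) := mul_nonneg (by positivity) (H_nonneg _ _ _)
  push_cast at key hb
  refine le_of_mul_le_mul_left ?_ (pow_pos hR 4)
  linarith

end SchrodingerDoubling

namespace SchrodingerDoubling

/-! ### Solutions on a ball -/

lemma bound_of_w1inftyNorm_le {n : ℕ} {F : Type*} [NormedAddCommGroup F] [NormedSpace ℝ F]
    [CompleteSpace F] {Ω : Set (𝔼 n)} {f : (𝔼 n) → F} (h : w1inftyNorm Ω f ≤ 1) :
    AEStronglyMeasurable f (volume.restrict Ω) ∧ ∀ᵐ x ∂(volume.restrict Ω), ‖f x‖ ≤ 1 := by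
  constructor
  -- Finiteness of the norm forces a weak derivative to exist, hence measurability; otherwise the
  -- infimum is over the empty set.
  · by_contra hn
    have : w1inftyNorm Ω f = ⊤ := by
      simp only [w1inftyNorm, iInf_eq_top]
      exact fun f' hf' => absurd hf'.1.aestronglyMeasurable hn
    rw [this] at h
    exact absurd h (by simp)
  · have h1 : eLpNorm f ⊤ (volume.restrict Ω) ≤ 1 :=
      le_trans (le_iInf₂ fun f' _ => le_self_add) h
    rw [eLpNorm_exponent_top] at h1
    filter_upwards [ae_le_eLpNormEssSup (f := f) (μ := volume.restrict Ω)] with x hx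
    have := hx.trans h1
    rwa [← ofReal_norm, ENNReal.ofReal_le_one] at this

lemma isSmoothLimit_of_solution {n : ℕ} {Ω : Set (𝔼 n)} (hΩ : MeasurableSet Ω)
    {W : (𝔼 n) → (𝔼 n)} {V u : (𝔼 n) → ℝ} (hW : w1inftyNorm Ω W ≤ 1) (hV : w1inftyNorm Ω V ≤ 1)
    (hu : IsSolutionOn Ω W V u) :
    ∃ (G : (𝔼 n) → (𝔼 n)) (f : (𝔼 n) → ℝ), ∀ (x : 𝔼 n) (T T' : ℝ), T < T' → closedBall x T' ⊆ Ω →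
      IsSmoothLimit x T u G f ∧ ∀ᵐ y ∂(volume.restrict (ball x T)), |f y| ≤ ‖G y‖ + |u y| := by
  obtain ⟨G, hw, hL2, ht⟩ := hu
  obtain ⟨mW, bW⟩ := bound_of_w1inftyNorm_le hW
  obtain ⟨mV, bV⟩ := bound_of_w1inftyNorm_le hV
  have hf : ∀ᵐ y ∂(volume.restrict Ω), |inner ℝ (W y) (G y) + V y * u y| ≤ ‖G y‖ + |u y| := by
    filter_upwards [bW, bV] with y h1 h2
    refine (abs_add_le _ _).trans (add_le_add ?_ ?_)
    · exact (abs_real_inner_le_norm _ _).trans (mul_le_of_le_one_left (norm_nonneg _) h1)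
    · rw [abs_mul]; exact mul_le_of_le_one_left (abs_nonneg _) h2
  refine ⟨G, fun y => inner ℝ (W y) (G y) + V y * u y, fun x T T' hT hsub => ⟨?_, ?_⟩⟩
  · obtain ⟨hu2, hG2⟩ := hL2 _ hsub (isCompact_closedBall x T')
    have hle := Measure.restrict_mono hsub (le_refl (volume : Measure (𝔼 n)))
    have hf2 : MemLp (fun y => inner ℝ (W y) (G y) + V y * u y) 2
        (volume.restrict (closedBall x T')) := by
      refine (hG2.norm.add hu2.norm).of_le
        (((mW.mono_measure hle).inner hG2.1).add ((mV.mono_measure hle).mul hu2.1)) ?_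
      filter_upwards [ae_mono hle hf] with y hy
      refine hy.trans ?_
      rw [Real.norm_eq_abs]
      exact le_abs_self _
    exact exists_smooth_approx hΩ hT hsub hw hu2 hG2 hf2 ht
  · exact ae_mono (Measure.restrict_mono
      (ball_subset_closedBall.trans ((closedBall_subset_closedBall hT.le).trans hsub)) le_rfl) hf

lemma ofReal_H_eq {n : ℕ} {u : (𝔼 n) → ℝ} {x : 𝔼 n} {r : ℝ}
    (hu : MemLp u 2 (volume.restrict (ball x r))) :
    ENNReal.ofReal (H u x r) = eLpNorm u 2 (volume.restrict (ball x r)) ^ 2 := by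
  have e : eLpNorm u 2 (volume.restrict (ball x r)) ^ 2 = ∫⁻ y in ball x r, ‖u y‖ₑ ^ 2 := by
    simpa using eLpNorm_nnreal_pow_eq_lintegral (f := u) (μ := volume.restrict (ball x r)) (p := 2)
      (by simp)
  rw [e, H, ofReal_integral_eq_lintegral_ofReal hu.integrable_sq (ae_of_all _ fun y => sq_nonneg _)]
  refine lintegral_congr fun y => ?_
  rw [← ofReal_norm, ← ENNReal.ofReal_pow (norm_nonneg _), Real.norm_eq_abs, sq_abs]

/-- The doubling inequality with an explicit constant. -/
theorem log_doubling_le {n : ℕ} (hn : 2 ≤ n) {R : ℝ} (hR : 0 < R) {W : (𝔼 n) → (𝔼 n)}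
    {V u : (𝔼 n) → ℝ}
    (hVW : w1inftyNorm (ball 0 R) V + w1inftyNorm (ball 0 R) W ≤ 1)
    (hsol : IsSolutionOn (ball 0 R) W V u) (hne : ¬ (u =ᵐ[volume.restrict (ball 0 R)] 0))
    {K : ℝ} (hK : 1 ≤ K)
    (hle : eLpNorm u 2 (volume.restrict (ball 0 R))
      ≤ ENNReal.ofReal K * eLpNorm u 2 (volume.restrict (ball 0 (R / 2))))
    {x : 𝔼 n} (hx : x ∈ ball (0 : 𝔼 n) (R / 2)) {r : ℝ} (hr : 0 < r) (hrR : r ≤ R / 8) :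
    0 < H u x r ∧ Real.log (H u x (2 * r) / H u x r) ≤
      ((461 + 72 * (924 * 80 ^ 4)) * 201) * (R ^ 2 + Real.log K) := by
  have hV : w1inftyNorm (ball 0 R) V ≤ 1 := le_self_add.trans hVW
  have hW : w1inftyNorm (ball 0 R) W ≤ 1 := le_add_self.trans hVW
  have hlogK : 0 ≤ Real.log K := Real.log_nonneg hK
  have mhalf : MemLp u 2 (volume.restrict (ball 0 (R / 2))) := by
    obtain ⟨G, -, h2, -⟩ := hsol
    exact (h2 _ (closedBall_subset_ball (by linarith)) (isCompact_closedBall 0 (R / 2))).1.mono_measure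
      (Measure.restrict_mono ball_subset_closedBall le_rfl)
  -- Square integrability up to the boundary comes from the bound by `K`, since the solution is only
  -- locally in `H¹`.
  have mfull : MemLp u 2 (volume.restrict (ball 0 R)) := by
    obtain ⟨G, h1, -, -⟩ := hsol
    exact ⟨h1.1.aestronglyMeasurable,
      hle.trans_lt (ENNReal.mul_lt_top ENNReal.ofReal_lt_top mhalf.2)⟩
  have iu : IntegrableOn (fun z => u z ^ 2) (ball 0 R) := mfull.integrable_sq
  have hHK : H u 0 R ≤ K ^ 2 * H u 0 (R / 2) := by
    have h1 := pow_le_pow_left' hle 2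
    rw [mul_pow, ← ofReal_H_eq mfull, ← ofReal_H_eq mhalf, ← ENNReal.ofReal_pow (by linarith),
      ← ENNReal.ofReal_mul (by positivity)] at h1
    exact (ENNReal.ofReal_le_ofReal_iff (mul_nonneg (by positivity) (H_nonneg _ _ _))).1 h1
  have hH0 : 0 < H u 0 R := by
    refine lt_of_le_of_ne (H_nonneg _ _ _) fun h0 => hne ?_
    have := (integral_eq_zero_iff_of_nonneg (fun z => sq_nonneg (u z)) iu).1 h0.symm
    filter_upwards [this] with z hz
    simpa using hz
  have hHhalf : 0 < H u 0 (R / 2) := by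
    by_contra hcon
    have : H u 0 (R / 2) = 0 := le_antisymm (not_lt.1 hcon) (H_nonneg _ _ _)
    rw [this, mul_zero] at hHK
    linarith
  obtain ⟨G, f, hGf⟩ := isSmoothLimit_of_solution measurableSet_ball hW hV hsol
  set B := 1 + R ^ 2 + Real.log K with hB
  have hR2 : 0 ≤ R ^ 2 := sq_nonneg R
  have hB1 : 1 ≤ B := by linarith
  have hexpK : Real.exp (2 * Real.log K) = K ^ 2 := by
    rw [two_mul, Real.exp_add, Real.exp_log (by linarith)]; ring
  -- If `R² + log K < 1/200`, the growth bound requires `K² ≥ 8.3 / 8.105`, contradicting `2 log K ≤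
  -- 1/100`.
  have hBle : B ≤ 201 * (R ^ 2 + Real.log K) := by
    obtain ⟨h1, h2⟩ := hGf 0 (9 * R / 10) (19 * R / 20) (by linarith)
      (closedBall_subset_ball (by linarith))
    have h3 := growth_lower_bound hn hR h1 h2
    have h4 : H u 0 (9 * R / 10) ≤ H u 0 R := H_mono (ball_subset_ball (by linarith)) iu
    suffices 1 ≤ 200 * (R ^ 2 + Real.log K) by linarith
    by_contra hlt
    push Not at hlt
    have hRs : R ^ 2 ≤ 1 / 200 := by linarith
    have hKs : 2 * Real.log K ≤ 1 / 100 := by linarith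
    have h5 : 83 / 10 * H u 0 (R / 2) ≤ (81 / 10 + 1 / 200) * (K ^ 2 * H u 0 (R / 2)) :=
      h3.trans (mul_le_mul (by linarith) (h4.trans hHK) (H_nonneg _ _ _) (by norm_num))
    have h6 : 83 / 10 ≤ (81 / 10 + 1 / 200) * K ^ 2 := by
      refine le_of_mul_le_mul_right ?_ hHhalf
      linarith
    have h7 := Real.one_sub_inv_le_log_of_pos (show 0 < K ^ 2 by positivity)
    rw [Real.log_pow] at h7
    push_cast at h7
    have h8 : (K ^ 2)⁻¹ ≤ (81 / 10 + 1 / 200) / (83 / 10) := by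
      rw [inv_le_comm₀ (by positivity) (by norm_num), inv_div, div_le_iff₀ (by norm_num)]
      linarith
    norm_num at h8
    linarith
  -- Doubling around `z` at outer radius `R / 2`, where the ball still lies in `B_R`; there `2T/3 =
  -- R/3` exceeds `R / 4`.
  have step : ∀ z ∈ ball (0 : 𝔼 n) (R / 2), ∀ l : ℝ,
      H u 0 R ≤ Real.exp l * H u z (R / 4) → ∀ s, 0 < s → s ≤ R / 6 →
      0 < H u z s ∧ H u z (2 * s) ≤ Real.exp (461 * (1 + R ^ 2) + 72 * l) * H u z s := by
    intro z hz l hl s hs hsR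
    have hz' : ‖z‖ < R / 2 := by simpa using hz
    have hzR : ball z (R / 2) ⊆ ball 0 R := ball_subset_ball' (by rw [dist_zero_right]; linarith)
    obtain ⟨h1, h2⟩ := hGf z (R / 2) ((R / 2 + (R - ‖z‖)) / 2) (by linarith)
      (closedBall_subset_ball' (by rw [dist_zero_right]; linarith))
    have i1 := iu.mono_set hzR
    have e1 : H u z (R / 4) ≤ H u z (2 * (R / 2) / 3) :=
      H_mono (ball_subset_ball (by linarith)) (i1.mono_set (ball_subset_ball (by linarith)))
    have e2 : H u 0 R ≤ Real.exp l * H u z (2 * (R / 2) / 3) :=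
      hl.trans (mul_le_mul_of_nonneg_left e1 (Real.exp_pos _).le)
    refine doubling_of_growth h1 h2 (by linarith) (by linarith) ?_ ((H_mono hzR iu).trans e2) hs
      (by linarith)
    exact pos_of_mul_pos_right (hH0.trans_le e2) (Real.exp_pos _).le
  -- The outer radius `3R/4` makes `2T/3` equal to `R / 2`, where the bound by `K` applies. Two
  -- doublings then descend to `R / 8`.
  have center : H u 0 R ≤ Real.exp (924 * B) * H u 0 (R / 8) := by
    obtain ⟨h1, h2⟩ := hGf 0 (3 * R / 4) (7 * R / 8) (by linarith)
      (closedBall_subset_ball (by linarith))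
    have e0 : 2 * (3 * R / 4) / 3 = R / 2 := by ring
    have e1 : H u 0 (3 * R / 4) ≤ Real.exp (2 * Real.log K) * H u 0 (2 * (3 * R / 4) / 3) := by
      rw [e0, hexpK]
      exact (H_mono (ball_subset_ball (by linarith)) iu).trans hHK
    have hpos : 0 < H u 0 (2 * (3 * R / 4) / 3) := by rwa [e0]
    have d1 := (doubling_of_growth h1 h2 (by linarith) (show 3 * R / 4 ≤ R by linarith) hpos e1
      (show 0 < R / 4 by linarith) (by linarith)).2
    have d2 := (doubling_of_growth h1 h2 (by linarith) (show 3 * R / 4 ≤ R by linarith) hpos e1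
      (show 0 < R / 8 by linarith) (by linarith)).2
    rw [show 2 * (R / 4) = R / 2 by ring] at d1
    rw [show 2 * (R / 8) = R / 4 by ring] at d2
    generalize hL : 461 * (1 + R ^ 2) + 72 * (2 * Real.log K) = L at d1 d2
    calc H u 0 R ≤ Real.exp (2 * Real.log K) * H u 0 (R / 2) := by rwa [hexpK]
      _ ≤ Real.exp (2 * Real.log K) * (Real.exp L * (Real.exp L * H u 0 (R / 8))) := by
          gcongr
          exact d1.trans (by gcongr)
      _ = Real.exp (2 * Real.log K + (L + L)) * H u 0 (R / 8) := by
          rw [Real.exp_add, Real.exp_add]; ring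
      _ ≤ _ := by
          refine mul_le_mul_of_nonneg_right (Real.exp_le_exp.2 ?_) (H_nonneg _ _ _)
          linarith
  have hx' : ‖x‖ < R / 2 := by simpa using hx
  -- Consecutive centres are at distance at most `R / 8`, so the ball of radius `R / 8` at one lies
  -- in the ball of radius `R / 4` at the next, where doubling returns to `R / 8`. Each move sends
  -- the exponent `l` to at most `73 l + 461 B`, which is below `80 l`.
  have chain : ∀ j : ℕ, j ≤ 4 →
      H u 0 R ≤ Real.exp (924 * 80 ^ j * B) * H u (((j : ℝ) / 4) • x) (R / 8) := by
    intro j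
    induction j with
    | zero => intro _; simpa using center
    | succ j ih =>
      intro hj
      have ih := ih (by omega)
      set y := ((j : ℝ) / 4) • x
      set z := (((j + 1 : ℕ) : ℝ) / 4) • x with hz
      have hjr : ((j + 1 : ℕ) : ℝ) ≤ 4 := by exact_mod_cast hj
      have hzn : ‖z‖ < R / 2 := by
        rw [hz, norm_smul, Real.norm_of_nonneg (by positivity)]
        exact (mul_le_of_le_one_left (norm_nonneg _) (by linarith)).trans_lt hx'
      have hyz : dist y z ≤ R / 8 := by
        rw [dist_eq_norm, ← sub_smul, norm_smul,
          show (j : ℝ) / 4 - ((j + 1 : ℕ) : ℝ) / 4 = -(1 / 4) by push_cast; ring, norm_neg,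
          Real.norm_of_nonneg (by norm_num)]
        linarith
      have i1 : IntegrableOn (fun w => u w ^ 2) (ball z (R / 4)) :=
        iu.mono_set (ball_subset_ball' (by rw [dist_zero_right]; linarith))
      have e1 : H u y (R / 8) ≤ H u z (R / 4) := H_mono (ball_subset_ball' (by linarith)) i1
      have e2 := ih.trans (mul_le_mul_of_nonneg_left e1 (Real.exp_pos _).le)
      have e3 := (step z (by simpa using hzn) _ e2 (R / 8) (by linarith) (by linarith)).2
      rw [show 2 * (R / 8) = R / 4 by ring] at e3
      refine e2.trans ((mul_le_mul_of_nonneg_left e3 (Real.exp_pos _).le).trans ?_)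
      rw [← mul_assoc, ← Real.exp_add]
      refine mul_le_mul_of_nonneg_right (Real.exp_le_exp.2 ?_) (H_nonneg _ _ _)
      have p1 : (1 : ℝ) ≤ 80 ^ j := one_le_pow₀ (by norm_num)
      have p2 : B ≤ 80 ^ j * B := le_mul_of_one_le_left (by linarith) p1
      rw [pow_succ (80 : ℝ) j]
      linarith
  have hfin := chain 4 le_rfl
  rw [show (((4 : ℕ) : ℝ) / 4) • x = x by norm_num] at hfin
  have hxR : ball x (R / 4) ⊆ ball 0 R := ball_subset_ball' (by rw [dist_zero_right]; linarith)
  have e1 : H u x (R / 8) ≤ H u x (R / 4) :=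
    H_mono (ball_subset_ball (by linarith)) (iu.mono_set hxR)
  obtain ⟨hp, hd⟩ := step x hx _ (hfin.trans (mul_le_mul_of_nonneg_left e1 (Real.exp_pos _).le)) r hr
    (by linarith)
  have hp2 : 0 < H u x (2 * r) := lt_of_lt_of_le hp
    (H_mono (ball_subset_ball (by linarith))
      (iu.mono_set ((ball_subset_ball (by linarith)).trans hxR)))
  refine ⟨hp, ?_⟩
  rw [Real.log_le_iff_le_exp (div_pos hp2 hp), div_le_iff₀ hp]
  refine hd.trans (mul_le_mul_of_nonneg_right (Real.exp_le_exp.2 ?_) hp.le)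
  linarith

end SchrodingerDoubling

theorem lemma5p3 (n : ℕ) (hn : 2 ≤ n) :
    ∃ C : ℝ, 1 ≤ C ∧
      ∀ (R : ℝ), 0 < R →
      ∀ (W : EuclideanSpace ℝ (Fin n) → EuclideanSpace ℝ (Fin n))
        (V u : EuclideanSpace ℝ (Fin n) → ℝ),
        SchrodingerDoubling.w1inftyNorm (ball 0 R) V
          + SchrodingerDoubling.w1inftyNorm (ball 0 R) W ≤ 1 →
        SchrodingerDoubling.IsSolutionOn (ball 0 R) W V u →
        ¬ (u =ᵐ[volume.restrict (ball 0 R)] 0) →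
      ∀ (K : ℝ), 1 ≤ K →
        eLpNorm u 2 (volume.restrict (ball 0 R))
          ≤ ENNReal.ofReal K * eLpNorm u 2 (volume.restrict (ball 0 (R / 2))) →
      ∀ x ∈ ball (0 : EuclideanSpace ℝ (Fin n)) (R / 2), ∀ r : ℝ, 0 < r → r ≤ R / 8 →
        0 < SchrodingerDoubling.H u x r ∧
        Real.log (SchrodingerDoubling.H u x (2 * r) / SchrodingerDoubling.H u x r)
          ≤ C * (R ^ 2 + Real.log K) := by
  -- The dimension cancels from the estimates, so one absolute constant serves every `n`.
  exact ⟨(461 + 72 * (924 * 80 ^ 4)) * 201, by norm_num,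
    fun R hR W V u hVW hsol hne K hK hle x hx r hr hrR =>
      SchrodingerDoubling.log_doubling_le hn hR hVW hsol hne hK hle hx hr hrR⟩
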